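/- Let $\Sigma_0,Q\in\mathbb R^{d\times d}$ be symmetric positive definite, let $\rho_0$ be the density of $\mathcal N(0,\Sigma_0)$ and $\rho^\ast$ the density of $\mathcal N(0,Q)$, and put $V=-\log\rho^\ast$. Consider the mean-field SVGD equation $$\partial_t\rho_t(x)=\nabla\cdot\Bigl(\rho_t(x)\int K(x,y)\bigl(\nabla\rho_t(y)+\rho_t(y)\nabla V(y)\bigr)\,dy\Bigr),\qquad t\ge 0,\tag{1}$$ with initial value $\rho_0$, where $K$ is either $K_1(x,y)=x^\top y+1$ or $K_2(x,y)=(x-\mu)^\top(y-\mu)+1$, with $\mu$ the mean of $\rho_t$. A weak solution of (1) is a curve $(\rho_t)_{t\ge0}$ of probability measures that is continuous in the space of probability measures with $\int(1+|V|)\,d\rho<\infty$ (tested against continuous functions dominated by a multiple of $1+|V|$), satisfies $\sup_{t\in[0,T]}\int(1+|V|)\,d\rho_t<\infty$ for all $T$, and $$\int_0^\infty\!\!\int\bigl(\partial_t\phi(t,x)+\nabla\phi(t,x)^\top U[\rho_t](x)\bigr)\rho_t(dx)\,dt+\int\phi(0,x)\,\rho_0(dx)=0\quad\text{for all }\phi\in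 C_c^\infty([0,\infty)\times\mathbb R^d),$$ where $U[\rho](x)=\int\bigl(\nabla_yK(x,y)-K(x,y)\nabla V(y)\bigr)\rho(dy)$. Then: 1. The Riccati-type equation $$\dot\Sigma_t=2\Sigma_t-\Sigma_t^2Q^{-1}-Q^{-1}\Sigma_t^2$$ with initial value $\Sigma_0$ has a unique global solution on $[0,\infty)$, and $\Sigma_t$ is symmetric positive definite for all $t\ge0$. 2. For $K=K_1$ and for $K=K_2$, the solution of (1) is $\rho_t=\mathcal N(0,\Sigma_t)$, $t\ge0$: the Gaussian densities $\rho_t$ are smooth and satisfy (1) pointwise, they form a weak solution, and this weak solution is the only one with initial value $\rho_0$. 3. If $\Sigma_0Q=Q\Sigma_0$, then $\Sigma_t^{-1}=e^{-2t}\Sigma_0^{-1}+(1-e^{-2t})Q^{-1}$ for all $t\ge0$. 4. If $\Sigma_0=I$ and $Q=I+\eta vv^\top$ with $\eta>0$, $v\in\mathbb R^d$, $v^\top v=1$, then for all $t\ge0$ $$\Sigma_t=I+\frac{\eta(1-e^{-2t})}{1+\eta e^{-2t}}\,vv^\top .$$ -/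

import Mathlib

open MeasureTheory ProbabilityTheory Set Matrix
open scoped ContDiff NNReal

namespace GaussianSVGD

/-- `d`-dimensional Euclidean space. -/
abbrev E (d : ℕ) : Type := EuclideanSpace ℝ (Fin d)

/-- A kernel `K (x, y)` that is allowed to depend on the current (mean-field) distribution. -/
abbrev MFKernel (d : ℕ) : Type := Measure (E d) → E d → E d → ℝ

/-- The simple bilinear kernel `xᵀ y + 1`. -/
noncomputable def kernelOne (d : ℕ) : MFKernel d :=
  fun _ x y => inner ℝ x y + 1

/-- The affine-invariant bilinear kernel `(x - m)ᵀ (y - m) + 1`, where `m` is the mean of the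
current distribution `ρ`. -/
noncomputable def kernelTwo (d : ℕ) : MFKernel d :=
  fun ρ x y => inner ℝ (x - ∫ z, z ∂ρ) (y - ∫ z, z ∂ρ) + 1

/-- The density of the centered Gaussian distribution with (positive definite) covariance `S`:
`(2π)^(-d/2) (det S)^(-1/2) exp (-xᵀ S⁻¹ x / 2)`. -/
noncomputable def gaussianDensity {d : ℕ} (S : Matrix (Fin d) (Fin d) ℝ) (x : E d) : ℝ :=
  (√((2 * Real.pi) ^ d * S.det))⁻¹ * Real.exp (-(1 / 2) * (x.ofLp ⬝ᵥ (S⁻¹ *ᵥ x.ofLp)))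

/-- The potential `V = -log ρ*` of a target density `ρ*`. -/
noncomputable def potential {d : ℕ} (target : E d → ℝ) (x : E d) : ℝ :=
  -Real.log (target x)

/-- The measure with density `p` with respect to Lebesgue measure. -/
noncomputable def densityMeasure {d : ℕ} (p : E d → ℝ) : Measure (E d) :=
  volume.withDensity fun x => ENNReal.ofReal (p x)

/-- The divergence of a vector field on Euclidean space: the sum of `∂ Fᵢ / ∂ xᵢ`. -/
noncomputable def divergence {d : ℕ} (F : E d → E d) (x : E d) : ℝ :=
  ∑ i, (fderiv ℝ F x (EuclideanSpace.single i 1)) i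

/-- The vector field
`x ↦ p x • ∫ K (x, y) (∇ p (y) + p (y) ∇ V (y)) dy`
whose divergence is the right-hand side of the mean-field SVGD equation. -/
noncomputable def svgdFlux {d : ℕ} (K : MFKernel d) (V p : E d → ℝ) (x : E d) : E d :=
  p x • ∫ y, K (densityMeasure p) x y • (gradient p y + p y • gradient V y)

/-- Classical solutions on `[0, ∞)` of the mean-field SVGD equation
`∂ₜ pₜ (x) = ∇ · (pₜ (x) ∫ K (x, y) (∇ pₜ (y) + pₜ (y) ∇ V (y)) dy)`
in the space of smooth probability densities. At `t = 0` the time derivative is one-sided. -/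
structure IsClassicalSolution {d : ℕ} (K : MFKernel d) (V p₀ : E d → ℝ)
    (p : ℝ → E d → ℝ) : Prop where
  initial : p 0 = p₀
  smooth : ∀ t, 0 ≤ t → ContDiff ℝ ∞ (p t)
  nonneg : ∀ t, 0 ≤ t → ∀ x, 0 ≤ p t x
  integrable : ∀ t, 0 ≤ t → Integrable (p t)
  mass_one : ∀ t, 0 ≤ t → ∫ x, p t x = 1
  integrable_flux : ∀ t, 0 ≤ t → ∀ x, Integrable fun y =>
    K (densityMeasure (p t)) x y • (gradient (p t) y + p t y • gradient V y)
  differentiable_flux : ∀ t, 0 ≤ t → Differentiable ℝ (svgdFlux K V (p t))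
  equation : ∀ t, 0 ≤ t → ∀ x,
    HasDerivWithinAt (fun s => p s x) (divergence (svgdFlux K V (p t)) x) (Ici 0) t

/-- The mean-field SVGD velocity field
`U[ρ] (x) = ∫ (∇_y K (x, y) - K (x, y) ∇ V (y)) ρ (dy)`.
If `ρ` has a density `p` this is `-∫ K (x, y) (∇ p (y) + p (y) ∇ V (y)) dy`
(integrate by parts), so that the SVGD equation reads `∂ₜ ρₜ + ∇ · (ρₜ U[ρₜ]) = 0`. -/
noncomputable def svgdVelocity {d : ℕ} (K : MFKernel d) (V : E d → ℝ) (ρ : Measure (E d))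
    (x : E d) : E d :=
  ∫ y, (gradient (fun z => K ρ x z) y - K ρ x y • gradient V y) ∂ρ

/-- Weak solutions on `[0, ∞)`, with initial value `ν`, of the mean-field SVGD equation
`∂ₜ ρₜ + ∇ · (ρₜ U[ρₜ]) = 0` in the class of continuous curves in the space of probability
measures with `∫ (1 + |V|) dρ < ∞`. That space carries the topology generated by the
integrals of the continuous functions that are dominated by a multiple of `1 + |V|`. Only the
values `ρ t` with `0 ≤ t` matter. -/
structure IsWeakSolution {d : ℕ} (K : MFKernel d) (V : E d → ℝ) (ν : Measure (E d))
    (ρ : ℝ → Measure (E d)) : Prop where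
  initial : ρ 0 = ν
  probability : ∀ t, 0 ≤ t → IsProbabilityMeasure (ρ t)
  bounded : ∀ T : ℝ, ∃ C : ℝ≥0, ∀ t ∈ Icc 0 T, ∫⁻ x, ENNReal.ofReal (1 + |V x|) ∂(ρ t) ≤ C
  continuous : ∀ f : E d → ℝ, Continuous f → (∃ C : ℝ, ∀ x, |f x| ≤ C * (1 + |V x|)) →
    ContinuousOn (fun t => ∫ x, f x ∂(ρ t)) (Ici 0)
  equation : ∀ φ : ℝ × E d → ℝ, ContDiff ℝ ∞ φ → HasCompactSupport φ →
    (∫ t in Ioi 0, ∫ x, (deriv (fun s => φ (s, x)) t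
        + inner ℝ (gradient (fun z => φ (t, z)) x) (svgdVelocity K V (ρ t) x)) ∂(ρ t))
      + ∫ x, φ (0, x) ∂ν = 0

/-- `S` solves `S' = 2 S - S² Q⁻¹ - Q⁻¹ S²` on `[0, ∞)` with `S 0 = S₀`. -/
structure IsRiccatiSolution {d : ℕ} (Q S₀ : Matrix (Fin d) (Fin d) ℝ)
    (S : ℝ → Matrix (Fin d) (Fin d) ℝ) : Prop where
  initial : S 0 = S₀
  equation : ∀ t, 0 ≤ t →
    HasDerivWithinAt S ((2 : ℝ) • S t - S t ^ 2 * Q⁻¹ - Q⁻¹ * S t ^ 2) (Ici 0) t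

end GaussianSVGD

/-!
For a quadratic potential and a bilinear kernel the SVGD velocity field is affine in `x`, and its
coefficients depend only on the mean and the second moments of the current measure
(`exists_velocity_coefficients`). At the centered Gaussian `N(0, S)` it is `x ↦ (1 - Q⁻¹ S) x`, for
both kernels. So one expects the curve of Gaussians whose covariance solves the Riccati equation.

*The Riccati equation.* Its solution is sought in the form `S = Φ S₀ Φᵀ`, where `Φ` is the flow of
the velocity field: `Φ' = (1 - Q⁻¹ Φ S₀ Φᵀ) Φ`. Then `tr (Φᵀ Q Φ)` grows at most exponentially, so
the solution is global (`exists_riccati_flow`). As `Φ` also solves a linear equation with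
continuous coefficients, it is invertible (`exists_riccati_invertible_flow`), and `S` is positive
definite. Uniqueness is that of locally Lipschitz equations (`riccati_unique`). The closed forms
hold because `S⁻¹` solves a linear equation when `S₀` and `Q` commute (`riccati_commuting`).

*The Gaussians are solutions.* Pointwise, the time derivative of the density and the divergence of
the flux are computed and compared (`isClassicalSolution_gaussian`). Weakly,
`N(0, S(t))` is the image of `N(0, S₀)` under `Φ(t)`, and integrating the derivative of
`φ(t, Φ(t) x)` gives the weak equation (`weak_equation_of_flow`, `isWeakSolution_gaussian`).

*Uniqueness of weak solutions.* Let `ρ` be a weak solution. As `V` grows quadratically, its mean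
`m` and its second moments exist and are continuous in time. Hence `ρ` solves a *linear*
transport equation whose velocity field `x ↦ B(t) x + b(t)` has continuous coefficients. The affine
flow of this field has an inverse `Y(t)`, and the image of `ρ(t)` under `Y(t)` does not depend on
`t` (`map_inverse_flow_eq`). So `ρ(t)` is the image of `N(0, S₀)` under an affine map. Since
`b(t) = Γ(t) m(t)`, the mean satisfies `m' = (B + Γ) m` and `m(0) = 0`; so `m = 0`, and
`ρ(t) = N(0, Φ(t) S₀ Φ(t)ᵀ)` with the fundamental matrix `Φ` of `B`. Therefore
`B = 1 - Q⁻¹ Φ S₀ Φᵀ`, and the covariance solves the Riccati equation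
(`IsWeakSolution.eq_gaussian`).
-/

namespace GaussianSVGD

/-! ### Global solutions of ordinary differential equations -/

/-!
The equations are written as `x' = L(t) g(x)` with `L(t)` linear and continuous in `t` and `g`
continuously differentiable. With `g = id` these are the linear equations, and with constant `L`
the autonomous ones.
-/

section ODE

variable {G H : Type*} [NormedAddCommGroup G] [NormedSpace ℝ G]
  [NormedAddCommGroup H] [NormedSpace ℝ H]

/-- For a bounded vector field the Picard–Lindelöf theorem applies on a ball so large that the
solution cannot leave it before time `T`; so there is no restriction on `T`. -/
theorem exists_solution_of_bounded_of_lipschitz [CompleteSpace G] {v : ℝ → G → G} {T : ℝ}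
    (hT : 0 ≤ T) {C K : ℝ≥0} (hlip : ∀ t ∈ Icc 0 T, LipschitzWith K (v t))
    (hcont : ∀ x, ContinuousOn (v · x) (Icc 0 T))
    (hbd : ∀ t ∈ Icc 0 T, ∀ x, ‖v t x‖ ≤ C) (x₀ : G) :
    ∃ x : ℝ → G, x 0 = x₀ ∧
      ∀ t ∈ Icc 0 T, HasDerivWithinAt x (v t (x t)) (Icc 0 T) t := by
  have h : IsPicardLindelof v (⟨0, ⟨le_rfl, hT⟩⟩ : Icc 0 T) x₀ (C * ⟨T, hT⟩) 0 C K :=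
    { lipschitzOnWith := fun t ht => (hlip t ht).lipschitzOnWith
      continuousOn := fun x _ => hcont x
      norm_le := fun t ht x _ => hbd t ht x
      mul_max_le := by
        rw [max_eq_left (by simpa using hT), sub_zero, NNReal.coe_zero, sub_zero]
        exact le_rfl }
  exact h.exists_eq_forall_mem_Icc_hasDerivWithinAt₀

theorem hasDerivWithinAt_Ici_of_Icc {x : ℝ → G} {x' : G} {t T : ℝ} (ht : t ∈ Ico 0 T)
    (h : HasDerivWithinAt x x' (Icc 0 T) t) : HasDerivWithinAt x x' (Ici t) t := by
  refine h.mono_of_mem_nhdsWithin ?_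
  exact Filter.mem_of_superset (Icc_mem_nhdsGE_of_mem ⟨le_rfl, ht.2⟩)
    (Icc_subset_Icc_left ht.1)

theorem hasDerivWithinAt_Ici_zero_of_Icc {x : ℝ → G} {x' : G} {t T : ℝ} (ht : t ∈ Ico 0 T)
    (h : HasDerivWithinAt x x' (Icc 0 T) t) : HasDerivWithinAt x x' (Ici 0) t := by
  refine h.mono_of_mem_nhdsWithin ?_
  have : Iio T ∈ nhdsWithin t (Ici 0) := mem_nhdsWithin_of_mem_nhds (Iio_mem_nhds ht.2)
  filter_upwards [this, self_mem_nhdsWithin] with s hs hs' using ⟨hs', le_of_lt hs⟩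

/-- Two solutions on a compact interval stay in a common ball, on which `g` is Lipschitz. -/
theorem eqOn_of_solution [FiniteDimensional ℝ G] {L : ℝ → H →L[ℝ] G} {g : G → H} {T : ℝ}
    (hL : ContinuousOn L (Icc 0 T)) (hg : ContDiff ℝ 1 g) {x y : ℝ → G} (h0 : x 0 = y 0)
    (hx : ∀ t ∈ Icc 0 T, HasDerivWithinAt x (L t (g (x t))) (Icc 0 T) t)
    (hy : ∀ t ∈ Icc 0 T, HasDerivWithinAt y (L t (g (y t))) (Icc 0 T) t) :
    EqOn x y (Icc 0 T) := by
  have hxc : ContinuousOn x (Icc 0 T) := fun t ht => (hx t ht).continuousWithinAt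
  have hyc : ContinuousOn y (Icc 0 T) := fun t ht => (hy t ht).continuousWithinAt
  obtain ⟨R₁, hR₁⟩ := isCompact_Icc.exists_bound_of_continuousOn hxc
  obtain ⟨R₂, hR₂⟩ := isCompact_Icc.exists_bound_of_continuousOn hyc
  obtain ⟨C, hC⟩ := isCompact_Icc.exists_bound_of_continuousOn hL
  have hconv : Convex ℝ (Metric.closedBall (0 : G) (max R₁ R₂)) := convex_closedBall _ _
  obtain ⟨K, hK⟩ := hg.contDiffOn.exists_lipschitzOnWith one_ne_zero hconv
    (isCompact_closedBall (0 : G) (max R₁ R₂))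
  refine ODE_solution_unique_of_mem_Icc_right (v := fun t z => L t (g z)) (K := C.toNNReal * K)
    (s := fun _ => Metric.closedBall 0 (max R₁ R₂)) ?_ hxc
    (fun t ht => hasDerivWithinAt_Ici_of_Icc ht (hx t (Ico_subset_Icc_self ht))) ?_ hyc
    (fun t ht => hasDerivWithinAt_Ici_of_Icc ht (hy t (Ico_subset_Icc_self ht))) ?_ h0
  · intro t ht
    refine LipschitzWith.comp_lipschitzOnWith ((L t).lipschitz.weaken ?_) hK
    have := hC t (Ico_subset_Icc_self ht)
    exact NNReal.coe_le_coe.1 (by simpa using Or.inl this)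
  · intro t ht
    simpa using Or.inl (hR₁ t (Ico_subset_Icc_self ht))
  · intro t ht
    simpa using Or.inr (hR₂ t (Ico_subset_Icc_self ht))

/-- Global existence for `x' = L(t) g(x)` from an a-priori bound. The bound is required, uniformly
in the cut-off `θ`, of the solutions of the equation whose vector field is multiplied by `θ`,
because these are the equations that are solved first. -/
theorem exists_global_solution [FiniteDimensional ℝ G]
    {L : ℝ → H →L[ℝ] G} (hL : ContinuousOn L (Ici 0)) {g : G → H} (hg : ContDiff ℝ 1 g) (x₀ : G)
    (apriori : ∀ T : ℝ, 0 ≤ T → ∃ R : ℝ, ∀ (θ : G → ℝ) (x : ℝ → G), (∀ z, θ z ∈ Icc 0 1) →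
      x 0 = x₀ → (∀ t ∈ Icc 0 T, HasDerivWithinAt x (θ (x t) • L t (g (x t))) (Icc 0 T) t) →
      ∀ t ∈ Icc 0 T, ‖x t‖ ≤ R) :
    ∃ x : ℝ → G, x 0 = x₀ ∧ ∀ t, 0 ≤ t → HasDerivWithinAt x (L t (g (x t))) (Ici 0) t := by
  have : CompleteSpace G := FiniteDimensional.complete ℝ G
  have hLT : ∀ T, ContinuousOn L (Icc 0 T) := fun T => hL.mono Icc_subset_Ici_self
  have key : ∀ T : ℝ, 0 ≤ T → ∃ x : ℝ → G, x 0 = x₀ ∧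
      ∀ t ∈ Icc 0 T, HasDerivWithinAt x (L t (g (x t))) (Icc 0 T) t := by
    intro T hT
    obtain ⟨R, hR⟩ := apriori T hT
    -- the cut-off `θ` makes the vector field bounded and Lipschitz, and equals `1` where the
    -- solution is known to stay
    let θ : ContDiffBump (0 : G) := ⟨|R| + 1, |R| + 2, by positivity, by linarith⟩
    have hsm : ContDiff ℝ 1 fun z => θ z • g z := θ.contDiff.smul hg
    have hsupp : HasCompactSupport fun z => θ z • g z := θ.hasCompactSupport.smul_right
    obtain ⟨K, hK⟩ := hsm.lipschitzWith_of_hasCompactSupport hsupp one_ne_zero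
    obtain ⟨B, hB⟩ := hsupp.exists_bound_of_continuous hsm.continuous
    obtain ⟨C, hC⟩ := isCompact_Icc.exists_bound_of_continuousOn (hLT T)
    have hC' : ∀ t ∈ Icc 0 T, ‖L t‖₊ ≤ C.toNNReal := fun t ht => by
      have := hC t ht
      exact NNReal.coe_le_coe.1 (by simpa using Or.inl this)
    obtain ⟨x, hx0, hx⟩ := exists_solution_of_bounded_of_lipschitz
      (v := fun t z => L t (θ z • g z)) (K := C.toNNReal * K) (C := C.toNNReal * B.toNNReal) hT
      (fun t ht => ((L t).lipschitz.weaken (hC' t ht)).comp hK)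
      (fun z _ ht => (hLT T _ ht).clm_apply continuousWithinAt_const)
      (fun t ht z => by
        refine ((L t).le_opNorm _).trans ?_
        have h1 : ‖L t‖ ≤ C.toNNReal := hC' t ht
        have h2 : ‖θ z • g z‖ ≤ B.toNNReal := (hB z).trans (Real.le_coe_toNNReal B)
        simpa using mul_le_mul h1 h2 (norm_nonneg _) (by positivity)) x₀
    have hbound := hR θ x (fun z => ⟨θ.nonneg, θ.le_one⟩) hx0
      (fun t ht => by simpa using hx t ht)
    refine ⟨x, hx0, fun t ht => ?_⟩
    have h1 : θ (x t) = 1 := θ.one_of_mem_closedBall (by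
      simpa using (hbound t ht).trans ((le_abs_self R).trans (by simp [θ])))
    simpa [h1] using hx t ht
  choose! X hX0 hX using key
  have huniq : ∀ S T : ℝ, 0 ≤ S → S ≤ T → EqOn (X S) (X T) (Icc 0 S) := fun S T hS hST =>
    eqOn_of_solution (hLT S) hg ((hX0 S hS).trans (hX0 T (hS.trans hST)).symm) (hX S hS)
      fun t ht => (hX T (hS.trans hST) t ⟨ht.1, ht.2.trans hST⟩).mono (Icc_subset_Icc_right hST)
  -- glue the solutions `X T` on `[0, T]`
  refine ⟨fun t => X t t, hX0 0 le_rfl, fun t ht => ?_⟩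
  have h1 : HasDerivWithinAt (X (t + 1)) (L t (g (X (t + 1) t))) (Ici 0) t :=
    hasDerivWithinAt_Ici_zero_of_Icc ⟨ht, by linarith⟩
      (hX (t + 1) (by linarith) t ⟨ht, by linarith⟩)
  have h2 : X t t = X (t + 1) t := huniq t (t + 1) ht (by linarith) ⟨ht, le_rfl⟩
  simp only [h2]
  refine h1.congr_of_eventuallyEq ?_ h2
  have : Iio (t + 1) ∈ nhdsWithin t (Ici 0) :=
    mem_nhdsWithin_of_mem_nhds (Iio_mem_nhds (by linarith))
  filter_upwards [this, self_mem_nhdsWithin] with s hs hs'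
  exact huniq s (t + 1) hs' (le_of_lt hs) ⟨hs', le_rfl⟩

theorem eqOn_Ici_of_solution [FiniteDimensional ℝ G] {L : ℝ → H →L[ℝ] G} {g : G → H}
    (hL : ContinuousOn L (Ici 0)) (hg : ContDiff ℝ 1 g) {x y : ℝ → G} (h0 : x 0 = y 0)
    (hx : ∀ t, 0 ≤ t → HasDerivWithinAt x (L t (g (x t))) (Ici 0) t)
    (hy : ∀ t, 0 ≤ t → HasDerivWithinAt y (L t (g (y t))) (Ici 0) t) :
    EqOn x y (Ici 0) := fun _ ht =>
  eqOn_of_solution (hL.mono Icc_subset_Ici_self) hg h0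
    (fun s hs => (hx s hs.1).mono Icc_subset_Ici_self)
    (fun s hs => (hy s hs.1).mono Icc_subset_Ici_self) ⟨ht, le_rfl⟩

theorem exists_global_solution_linear [FiniteDimensional ℝ G] {L : ℝ → G →L[ℝ] G}
    (hL : ContinuousOn L (Ici 0)) (x₀ : G) :
    ∃ x : ℝ → G, x 0 = x₀ ∧ ∀ t, 0 ≤ t → HasDerivWithinAt x (L t (x t)) (Ici 0) t := by
  refine exists_global_solution (g := id) hL contDiff_id x₀ fun T hT => ?_
  obtain ⟨C, hC⟩ := isCompact_Icc.exists_bound_of_continuousOn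
    (hL.mono (Icc_subset_Ici_self : Icc 0 T ⊆ Ici 0))
  have hC0 : 0 ≤ C := (norm_nonneg _).trans (hC 0 ⟨le_rfl, hT⟩)
  refine ⟨‖x₀‖ * Real.exp (C * T), fun θ x hθ h0 hx t ht => ?_⟩
  have h1 := norm_le_gronwallBound_of_norm_deriv_right_le (δ := ‖x₀‖) (K := C) (ε := 0)
    (fun s hs => (hx s hs).continuousWithinAt)
    (fun s hs => hasDerivWithinAt_Ici_of_Icc hs (hx s (Ico_subset_Icc_self hs)))
    (by rw [h0]) (fun s hs => ?_) t ht
  · rw [gronwallBound_ε0] at h1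
    refine h1.trans ?_
    gcongr
    linarith [ht.2]
  · rw [norm_smul, Real.norm_of_nonneg (hθ _).1, add_zero]
    calc θ (x s) * ‖L s (id (x s))‖ ≤ 1 * (‖L s‖ * ‖x s‖) := by
          gcongr
          · exact (hθ _).2
          · exact (L s).le_opNorm _
      _ ≤ C * ‖x s‖ := by
          rw [one_mul]; gcongr; exact hC s (Ico_subset_Icc_self hs)

theorem constant_of_hasDerivWithinAt_zero {x : ℝ → G}
    (h : ∀ t, 0 ≤ t → HasDerivWithinAt x 0 (Ici 0) t) {t : ℝ} (ht : 0 ≤ t) : x t = x 0 :=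
  constant_of_has_deriv_right_zero
    (fun s hs => ((h s hs.1).mono Icc_subset_Ici_self).continuousWithinAt)
    (fun s hs => (h s hs.1).mono (Ici_subset_Ici.2 hs.1)) t ⟨ht, le_rfl⟩

end ODE

/-! ### The Riccati equation -/

/-- The continuous linear map `x ↦ A x` of Euclidean space given by a matrix `A`. -/
noncomputable abbrev matCLM {d : ℕ} (A : Matrix (Fin d) (Fin d) ℝ) : E d →L[ℝ] E d :=
  toEuclideanCLM (𝕜 := ℝ) A

section Riccati

open scoped Matrix.Norms.Frobenius

variable {d : ℕ}

theorem hasDerivWithinAt_transpose {A : ℝ → Matrix (Fin d) (Fin d) ℝ}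
    {A' : Matrix (Fin d) (Fin d) ℝ} {s : Set ℝ} {t : ℝ} (h : HasDerivWithinAt A A' s t) :
    HasDerivWithinAt (fun r => (A r)ᵀ) A'ᵀ s t :=
  ((Matrix.transposeLinearEquiv (Fin d) (Fin d) ℝ ℝ).toLinearMap.toContinuousLinearMap
    |>.hasFDerivAt.comp_hasDerivWithinAt t h)

theorem hasDerivWithinAt_trace {A : ℝ → Matrix (Fin d) (Fin d) ℝ}
    {A' : Matrix (Fin d) (Fin d) ℝ} {s : Set ℝ} {t : ℝ} (h : HasDerivWithinAt A A' s t) :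
    HasDerivWithinAt (fun r => (A r).trace) A'.trace s t :=
  ((Matrix.traceLinearMap (Fin d) ℝ ℝ).toContinuousLinearMap
    |>.hasFDerivAt.comp_hasDerivWithinAt t h)

/-- A linear flow `Φ` together with its inverse `Ψ`. -/
theorem exists_fundamental_matrix {B : ℝ → Matrix (Fin d) (Fin d) ℝ}
    (hB : ContinuousOn B (Ici 0)) :
    ∃ Φ Ψ : ℝ → Matrix (Fin d) (Fin d) ℝ, Φ 0 = 1 ∧ Ψ 0 = 1 ∧
      (∀ t, 0 ≤ t → HasDerivWithinAt Φ (B t * Φ t) (Ici 0) t) ∧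
      (∀ t, 0 ≤ t → HasDerivWithinAt Ψ (-(Ψ t * B t)) (Ici 0) t) ∧
      (∀ t, 0 ≤ t → Ψ t * Φ t = 1) := by
  have hL : ContinuousOn
      (fun t => ContinuousLinearMap.mul ℝ (Matrix (Fin d) (Fin d) ℝ) (B t)) (Ici 0) :=
    (ContinuousLinearMap.mul ℝ (Matrix (Fin d) (Fin d) ℝ)).continuous.comp_continuousOn hB
  have hL' : ContinuousOn
      (fun t => -(ContinuousLinearMap.mul ℝ (Matrix (Fin d) (Fin d) ℝ)).flip (B t)) (Ici 0) :=
    ((ContinuousLinearMap.mul ℝ (Matrix (Fin d) (Fin d) ℝ)).flip.continuous.comp_continuousOn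
      hB).neg
  obtain ⟨Φ, hΦ0, hΦ⟩ : ∃ Φ : ℝ → Matrix (Fin d) (Fin d) ℝ, Φ 0 = 1 ∧
      ∀ t, 0 ≤ t → HasDerivWithinAt Φ (B t * Φ t) (Ici 0) t :=
    exists_global_solution_linear hL 1
  obtain ⟨Ψ, hΨ0, hΨ⟩ : ∃ Ψ : ℝ → Matrix (Fin d) (Fin d) ℝ, Ψ 0 = 1 ∧
      ∀ t, 0 ≤ t → HasDerivWithinAt Ψ (-(Ψ t * B t)) (Ici 0) t :=
    exists_global_solution_linear hL' 1
  refine ⟨Φ, Ψ, hΦ0, hΨ0, hΦ, hΨ, fun t ht => ?_⟩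
  have h := constant_of_hasDerivWithinAt_zero (x := Ψ * Φ) (fun s hs => by
    have h1 := (hΨ s hs).mul (hΦ s hs)
    rwa [neg_mul, Matrix.mul_assoc, neg_add_cancel] at h1) ht
  simpa [hΦ0, hΨ0] using h

theorem continuous_matCLM :
    Continuous (matCLM : Matrix (Fin d) (Fin d) ℝ → E d →L[ℝ] E d) :=
  (toEuclideanCLM (n := Fin d) (𝕜 := ℝ)).toAlgEquiv.toLinearMap.continuous_of_finiteDimensional

/-- A solution of a linear equation that starts at zero is zero. -/
theorem eq_zero_of_linear {m : ℝ → E d} {B : ℝ → Matrix (Fin d) (Fin d) ℝ}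
    (hB : ContinuousOn B (Ici 0)) (h0 : m 0 = 0)
    (hm : ∀ t, 0 ≤ t → HasDerivWithinAt m (matCLM (B t) (m t)) (Ici 0) t) :
    ∀ t, 0 ≤ t → m t = 0 := fun t ht =>
  eqOn_Ici_of_solution (g := id) (y := fun _ => 0) (continuous_matCLM.comp_continuousOn hB)
    contDiff_id h0 hm (fun s _ => by simpa using hasDerivWithinAt_const s _ (0 : E d)) ht

theorem riccati_unique {Q S₀ : Matrix (Fin d) (Fin d) ℝ} {S S' : ℝ → Matrix (Fin d) (Fin d) ℝ}
    (hS : IsRiccatiSolution Q S₀ S) (hS' : IsRiccatiSolution Q S₀ S') :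
    ∀ t, 0 ≤ t → S' t = S t := by
  have hg : ContDiff ℝ 1 fun S : Matrix (Fin d) (Fin d) ℝ =>
    (2 : ℝ) • S - S ^ 2 * Q⁻¹ - Q⁻¹ * S ^ 2 := by fun_prop
  exact fun t ht => eqOn_Ici_of_solution (L := fun _ => ContinuousLinearMap.id ℝ _)
    continuousOn_const hg (hS'.initial.trans hS.initial.symm) hS'.equation hS.equation ht

open scoped MatrixOrder in
/-- The square root of a positive definite matrix is symmetric and invertible. -/
theorem exists_symm_sqrt {Q : Matrix (Fin d) (Fin d) ℝ} (hQ : Q.PosDef) :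
    ∃ B : Matrix (Fin d) (Fin d) ℝ, IsUnit B.det ∧ Bᵀ = B ∧ B * B = Q := by
  have h : CFC.sqrt Q * CFC.sqrt Q = Q := CFC.sqrt_mul_sqrt_self Q hQ.posSemidef.nonneg
  refine ⟨CFC.sqrt Q, ?_, ?_, h⟩
  · have hd := hQ.det_pos.ne'
    rw [← h, det_mul] at hd
    exact (right_ne_zero_of_mul hd).isUnit
  · have := (CFC.sqrt_nonneg Q).posSemidef.isHermitian
    rwa [Matrix.IsHermitian, conjTranspose_eq_transpose_of_trivial] at this

theorem sq_frobenius_norm (A : Matrix (Fin d) (Fin d) ℝ) : ‖A‖ ^ 2 = (Aᵀ * A).trace := by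
  rw [Matrix.frobenius_norm_def, ← Real.sqrt_eq_rpow, Real.sq_sqrt (by positivity),
    Finset.sum_comm]
  simp [Matrix.trace, Matrix.mul_apply, pow_two]

/-- The derivative of `tr (Φᵀ Q Φ)` along `Φ' = Φ - Q⁻¹ Φ S₀ Φᵀ Φ` is at most twice
`tr (Φᵀ Q Φ)`, because `tr (Φᵀ Φ S₀ Φᵀ Φ) ≥ 0`; hence `Φ` cannot blow up. The matrix
`Φ S₀ Φᵀ` then solves the Riccati equation. -/
theorem exists_riccati_flow {Q S₀ : Matrix (Fin d) (Fin d) ℝ} (hS₀ : S₀.PosDef) (hQ : Q.PosDef) :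
    ∃ Φ : ℝ → Matrix (Fin d) (Fin d) ℝ, Φ 0 = 1 ∧ ∀ t, 0 ≤ t →
      HasDerivWithinAt Φ ((1 - Q⁻¹ * (Φ t * S₀ * (Φ t)ᵀ)) * Φ t) (Ici 0) t := by
  -- `fun_prop` finds this fact among the hypotheses
  have htr : ContDiff ℝ 1 fun Φ : Matrix (Fin d) (Fin d) ℝ => Φᵀ :=
    (Matrix.transposeLinearEquiv (Fin d) (Fin d) ℝ ℝ).toLinearMap.toContinuousLinearMap.contDiff
  have hg : ContDiff ℝ 1 fun Φ : Matrix (Fin d) (Fin d) ℝ =>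
    (1 - Q⁻¹ * (Φ * S₀ * Φᵀ)) * Φ := by fun_prop
  obtain ⟨B, hBu, hBt, hBQ⟩ := exists_symm_sqrt hQ
  have hQu : IsUnit Q.det := hQ.det_pos.ne'.isUnit
  refine exists_global_solution (L := fun _ => ContinuousLinearMap.id ℝ _)
    continuousOn_const hg 1 fun T hT => ?_
  refine ⟨‖B⁻¹‖ * Real.sqrt (‖B‖ ^ 2 * Real.exp (2 * T)), fun θ Φ hθ h0 hΦ t ht => ?_⟩
  simp only [ContinuousLinearMap.id_apply] at hΦ
  -- `f s = tr (Φᵀ Q Φ)` is the square of a norm of `Φ`, and grows at most like `exp (2 s)`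
  set f : ℝ → ℝ := fun s => ((Φ s)ᵀ * (Q * Φ s)).trace with hf
  have hfB : ∀ s, f s = ‖B * Φ s‖ ^ 2 := fun s => by
    rw [sq_frobenius_norm, transpose_mul, hBt, Matrix.mul_assoc, ← Matrix.mul_assoc B B, hBQ]
  have hQt : Qᵀ = Q := by rw [← hBQ, transpose_mul, hBt]
  have hf' : ∀ s ∈ Icc 0 T, HasDerivWithinAt f
      (2 * θ (Φ s) * (f s - ((Φ s)ᵀ * Φ s * S₀ * ((Φ s)ᵀ * Φ s)ᵀ).trace)) (Icc 0 T) s := by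
    intro s hs
    have h1 := (hasDerivWithinAt_transpose (hΦ s hs)).mul ((hΦ s hs).const_mul Q)
    refine (hasDerivWithinAt_trace h1).congr_deriv ?_
    have e : (Φ s)ᵀ * (Q * (θ (Φ s) • ((1 - Q⁻¹ * (Φ s * S₀ * (Φ s)ᵀ)) * Φ s))) =
        θ (Φ s) • ((Φ s)ᵀ * (Q * Φ s) - (Φ s)ᵀ * Φ s * S₀ * ((Φ s)ᵀ * Φ s)ᵀ) := by
      rw [Matrix.mul_smul, Matrix.mul_smul, sub_mul, Matrix.mul_sub, Matrix.mul_sub, one_mul,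
        ← Matrix.mul_assoc Q, ← Matrix.mul_assoc Q, mul_nonsing_inv _ hQu, one_mul,
        transpose_mul, transpose_transpose]
      simp only [Matrix.mul_assoc]
    have e' : (θ (Φ s) • ((1 - Q⁻¹ * (Φ s * S₀ * (Φ s)ᵀ)) * Φ s))ᵀ * (Q * Φ s) =
        ((Φ s)ᵀ * (Q * (θ (Φ s) • ((1 - Q⁻¹ * (Φ s * S₀ * (Φ s)ᵀ)) * Φ s))))ᵀ := by
      simp only [transpose_mul, transpose_transpose, hQt, Matrix.mul_assoc]
    rw [trace_add, e', trace_transpose,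
      e, trace_smul, trace_sub, hf, smul_eq_mul]
    ring
  have hfbd : f t ≤ f 0 * Real.exp (2 * t) := by
    have h1 := le_gronwallBound_of_liminf_deriv_right_le (f := f) (δ := f 0) (K := 2) (ε := 0)
      (fun s hs => (hf' s hs).continuousWithinAt)
      (fun s hs r hr => (hasDerivWithinAt_Ici_of_Icc hs
        (hf' s (Ico_subset_Icc_self hs))).liminf_right_slope_le hr) le_rfl
      (fun s _ => ?_) t ht
    · simpa [gronwallBound_ε0] using h1
    · have h2 : 0 ≤ ((Φ s)ᵀ * Φ s * S₀ * ((Φ s)ᵀ * Φ s)ᵀ).trace := by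
        have := hS₀.posSemidef.mul_mul_conjTranspose_same ((Φ s)ᵀ * Φ s)
        rw [conjTranspose_eq_transpose_of_trivial] at this
        exact this.trace_nonneg
      have h3 : 0 ≤ f s := by rw [hfB]; positivity
      obtain ⟨h4, h5⟩ := hθ (Φ s)
      nlinarith [mul_nonneg h4 h2, mul_nonneg (sub_nonneg.2 h5) h3]
  have h1 : ‖B * Φ t‖ ≤ Real.sqrt (‖B‖ ^ 2 * Real.exp (2 * T)) := by
    refine Real.le_sqrt_of_sq_le ?_
    rw [← hfB]
    refine hfbd.trans ?_
    rw [hfB, h0, mul_one]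
    gcongr
    exact ht.2
  calc ‖Φ t‖ = ‖B⁻¹ * (B * Φ t)‖ := by rw [← Matrix.mul_assoc, nonsing_inv_mul _ hBu, one_mul]
    _ ≤ ‖B⁻¹‖ * ‖B * Φ t‖ := norm_mul_le _ _
    _ ≤ _ := by gcongr

theorem continuousOn_flow_coefficient {Q S₀ : Matrix (Fin d) (Fin d) ℝ}
    {Φ : ℝ → Matrix (Fin d) (Fin d) ℝ} (hΦ : ContinuousOn Φ (Ici 0)) :
    ContinuousOn (fun t => 1 - Q⁻¹ * (Φ t * S₀ * (Φ t)ᵀ)) (Ici 0) := by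
  have h : ContinuousOn (fun t => (Φ t)ᵀ) (Ici 0) :=
    (Continuous.matrix_transpose continuous_id).comp_continuousOn hΦ
  fun_prop

theorem isRiccatiSolution_of_flow {Q S₀ : Matrix (Fin d) (Fin d) ℝ} (hS₀ : S₀.PosDef)
    (hQ : Q.PosDef) {Φ : ℝ → Matrix (Fin d) (Fin d) ℝ} (h0 : Φ 0 = 1)
    (hΦ : ∀ t, 0 ≤ t →
      HasDerivWithinAt Φ ((1 - Q⁻¹ * (Φ t * S₀ * (Φ t)ᵀ)) * Φ t) (Ici 0) t) :
    IsRiccatiSolution Q S₀ fun t => Φ t * S₀ * (Φ t)ᵀ := by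
  have hSt : S₀ᵀ = S₀ := by
    simpa [Matrix.IsHermitian, conjTranspose_eq_transpose_of_trivial] using hS₀.isHermitian
  have hQt : (Q⁻¹)ᵀ = Q⁻¹ := by
    simpa [Matrix.IsHermitian, conjTranspose_eq_transpose_of_trivial] using hQ.inv.isHermitian
  refine ⟨by simp [h0], fun t ht => ?_⟩
  refine (((hΦ t ht).mul_const S₀).mul (hasDerivWithinAt_transpose (hΦ t ht))).congr_deriv ?_
  simp only [transpose_mul, transpose_sub, transpose_one, transpose_transpose, hSt, hQt]
  rw [two_smul, pow_two]
  noncomm_ring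

/-- The solution of the Riccati equation in the form `Φ S₀ Φᵀ`, where `Φ` is the flow of the
linear velocity field `x ↦ (1 - Q⁻¹ Φ S₀ Φᵀ) x`. -/
theorem exists_riccati_invertible_flow {Q S₀ : Matrix (Fin d) (Fin d) ℝ} (hS₀ : S₀.PosDef)
    (hQ : Q.PosDef) :
    ∃ Φ Ψ : ℝ → Matrix (Fin d) (Fin d) ℝ, Φ 0 = 1 ∧ (∀ t, 0 ≤ t → Ψ t * Φ t = 1) ∧
      ∀ t, 0 ≤ t → HasDerivWithinAt Φ ((1 - Q⁻¹ * (Φ t * S₀ * (Φ t)ᵀ)) * Φ t) (Ici 0) t := by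
  obtain ⟨Φ, h0, hΦ⟩ := exists_riccati_flow hS₀ hQ
  have hB : ContinuousOn (fun t => 1 - Q⁻¹ * (Φ t * S₀ * (Φ t)ᵀ)) (Ici 0) :=
    continuousOn_flow_coefficient fun t ht => (hΦ t ht).continuousWithinAt
  -- `Φ` itself solves a linear equation, so it is the fundamental matrix and has an inverse
  obtain ⟨Φ', Ψ, h0', -, hΦ', -, h⟩ := exists_fundamental_matrix hB
  refine ⟨Φ', Ψ, h0', h, ?_⟩
  have hL : ContinuousOn (fun t => ContinuousLinearMap.mul ℝ (Matrix (Fin d) (Fin d) ℝ)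
      (1 - Q⁻¹ * (Φ t * S₀ * (Φ t)ᵀ))) (Ici 0) :=
    (ContinuousLinearMap.mul ℝ (Matrix (Fin d) (Fin d) ℝ)).continuous.comp_continuousOn hB
  have heq : EqOn Φ' Φ (Ici 0) :=
    eqOn_Ici_of_solution (g := id) hL contDiff_id (h0'.trans h0.symm) hΦ' hΦ
  intro t ht
  rw [heq ht]
  exact (hΦ t ht).congr heq (heq ht)

theorem posDef_congr_of_left_inverse {S₀ Φ Ψ : Matrix (Fin d) (Fin d) ℝ} (hS₀ : S₀.PosDef)
    (h : Ψ * Φ = 1) : (Φ * S₀ * Φᵀ).PosDef := by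
  rw [← conjTranspose_eq_transpose_of_trivial]
  refine hS₀.mul_mul_conjTranspose_same fun v w hvw => ?_
  have h' : Φ * Ψ = 1 := mul_eq_one_comm.1 h
  simpa [vecMul_vecMul, h'] using congrArg (· ᵥ* Ψ) hvw

end Riccati

/-! ### Closed forms of Riccati solutions -/

section ClosedForm

open scoped Matrix.Norms.Frobenius

variable {d : ℕ}

theorem hasDerivWithinAt_matrix_inv {A : ℝ → Matrix (Fin d) (Fin d) ℝ}
    {A' : Matrix (Fin d) (Fin d) ℝ} {s : Set ℝ} {t : ℝ} (h : HasDerivWithinAt A A' s t)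
    (hA : IsUnit (A t)) :
    HasDerivWithinAt (fun r => (A r)⁻¹) (-((A t)⁻¹ * A' * (A t)⁻¹)) s t := by
  have : CompleteSpace (Matrix (Fin d) (Fin d) ℝ) := FiniteDimensional.complete ℝ _
  obtain ⟨u, hu⟩ := hA
  have h1 := hasFDerivAt_ringInverse (𝕜 := ℝ) u
  have h3 : (↑u⁻¹ : Matrix (Fin d) (Fin d) ℝ) = (A t)⁻¹ := by rw [← hu, coe_units_inv]
  rw [hu, h3] at h1
  have h2 := h1.comp_hasDerivWithinAt t h
  simp only [nonsing_inv_eq_ringInverse] at h2 ⊢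
  exact h2

/-- Jacobi's formula. -/
theorem hasDerivWithinAt_det {A : ℝ → Matrix (Fin d) (Fin d) ℝ}
    {A' : Matrix (Fin d) (Fin d) ℝ} {s : Set ℝ} {t : ℝ} (h : HasDerivWithinAt A A' s t) :
    HasDerivWithinAt (fun r => (A r).det) ((A t).adjugate * A').trace s t := by
  have hij : ∀ i j, HasDerivWithinAt (fun r => A r i j) (A' i j) s t := fun i j =>
    hasDerivWithinAt_pi.1 (hasDerivWithinAt_pi.1 h i) j
  simp only [det_apply]
  have h1 : HasDerivWithinAt (fun r => ∑ σ : Equiv.Perm (Fin d), σ.sign • ∏ i, A r (σ i) i)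
      (∑ σ : Equiv.Perm (Fin d), σ.sign • ∑ i, (∏ j ∈ Finset.univ.erase i, A t (σ j) j) •
        A' (σ i) i) s t :=
    HasDerivWithinAt.fun_sum fun σ _ =>
      (HasDerivWithinAt.fun_finsetProd fun i _ => hij (σ i) i).const_smul σ.sign
  refine h1.congr_deriv ?_
  simp only [Finset.smul_sum]
  rw [Finset.sum_comm, Matrix.trace]
  refine Finset.sum_congr rfl fun i _ => ?_
  have h2 : ((A t).adjugate * A').diag i = (A t).cramer (A'.col i) i := by
    rw [cramer_eq_adjugate_mulVec]; rfl
  rw [h2, cramer_apply, det_apply]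
  refine Finset.sum_congr rfl fun σ _ => ?_
  rw [← Finset.mul_prod_erase _ _ (Finset.mem_univ i), smul_eq_mul, mul_comm]
  congr 2
  · simp
  · exact Finset.prod_congr rfl fun j hj => by simp [Finset.ne_of_mem_erase hj]

/-- The right-hand side `P` satisfies `P' = 2 Q⁻¹ - 2 P` and commutes with `Q⁻¹`. Hence
`(P⁻¹)' = -P⁻¹ P' P⁻¹ = 2 P⁻¹ - 2 P⁻¹ Q⁻¹ P⁻¹` is the Riccati equation for `P⁻¹`. -/
theorem riccati_commuting {Q S₀ : Matrix (Fin d) (Fin d) ℝ} (hS₀ : S₀.PosDef) (hQ : Q.PosDef)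
    {S : ℝ → Matrix (Fin d) (Fin d) ℝ} (hS : IsRiccatiSolution Q S₀ S) (hc : S₀ * Q = Q * S₀)
    {t : ℝ} (ht : 0 ≤ t) :
    (S t)⁻¹ = Real.exp (-2 * t) • S₀⁻¹ + (1 - Real.exp (-2 * t)) • Q⁻¹ := by
  set P : ℝ → Matrix (Fin d) (Fin d) ℝ :=
    fun t => Real.exp (-2 * t) • S₀⁻¹ + (1 - Real.exp (-2 * t)) • Q⁻¹ with hP
  have hPpos : ∀ t, 0 ≤ t → (P t).PosDef := fun t ht =>
    (hS₀.inv.smul (Real.exp_pos _)).add_posSemidef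
      (hQ.inv.posSemidef.smul (by simpa using ht))
  have hPu : ∀ t, 0 ≤ t → IsUnit (P t) := fun t ht => (hPpos t ht).isUnit
  have hcomm : S₀⁻¹ * Q⁻¹ = Q⁻¹ * S₀⁻¹ := by rw [← Matrix.mul_inv_rev, ← Matrix.mul_inv_rev, hc]
  have hPQ : ∀ t, Commute Q⁻¹ (P t) := fun t => by
    simp [hP, Commute, SemiconjBy, mul_add, add_mul, hcomm]
  have hsol : IsRiccatiSolution Q S₀ fun t => (P t)⁻¹ := by
    refine ⟨by simp [hP, nonsing_inv_nonsing_inv _ hS₀.det_pos.ne'.isUnit], fun t ht => ?_⟩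
    have he : HasDerivAt (fun t : ℝ => Real.exp (-2 * t)) (Real.exp (-2 * t) * -2) t := by
      simpa using ((hasDerivAt_id t).const_mul (-2)).exp
    have hP' : HasDerivAt P ((2 : ℝ) • Q⁻¹ - (2 : ℝ) • P t) t := by
      refine ((he.smul_const S₀⁻¹).add ((he.const_sub 1).smul_const Q⁻¹)).congr_deriv ?_
      simp only [hP]
      module
    refine (hasDerivWithinAt_matrix_inv hP'.hasDerivWithinAt (hPu t ht)).congr_deriv ?_
    have hdet : IsUnit (P t).det := (isUnit_iff_isUnit_det _).1 (hPu t ht)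
    have hPQ' : Q⁻¹ * (P t)⁻¹ = (P t)⁻¹ * Q⁻¹ := by
      have h1 : (P t)⁻¹ * (Q⁻¹ * P t) * (P t)⁻¹ = (P t)⁻¹ * (P t * Q⁻¹) * (P t)⁻¹ := by
        rw [(hPQ t).eq]
      rw [← Matrix.mul_assoc (P t)⁻¹ (P t), nonsing_inv_mul _ hdet, one_mul, Matrix.mul_assoc,
        Matrix.mul_assoc, mul_nonsing_inv _ hdet, mul_one] at h1
      exact h1.symm
    have h2 : (P t)⁻¹ * P t = 1 := nonsing_inv_mul _ hdet
    have h3 : (P t)⁻¹ ^ 2 * Q⁻¹ = (P t)⁻¹ * Q⁻¹ * (P t)⁻¹ := by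
      rw [pow_two, Matrix.mul_assoc, Matrix.mul_assoc, hPQ']
    have h4 : Q⁻¹ * (P t)⁻¹ ^ 2 = (P t)⁻¹ * Q⁻¹ * (P t)⁻¹ := by
      rw [pow_two, ← Matrix.mul_assoc, hPQ']
    rw [h3, h4, mul_sub, sub_mul, Matrix.mul_smul, Matrix.mul_smul, h2, Matrix.smul_mul,
      Matrix.smul_mul, one_mul]
    module
  rw [riccati_unique hsol hS t ht, nonsing_inv_nonsing_inv]
  exact (isUnit_iff_isUnit_det _).1 (hPu t ht)

/-- As `S₀ = 1` commutes with `Q`, it remains to invert two matrices of the form `1 + c v vᵀ`, which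
is easy because `v vᵀ` is idempotent. -/
theorem riccati_rank_one {S : ℝ → Matrix (Fin d) (Fin d) ℝ} {η : ℝ} {v : Fin d → ℝ}
    (hη : 0 < η) (hv : v ⬝ᵥ v = 1) (hS : IsRiccatiSolution (1 + η • vecMulVec v v) 1 S)
    (hQ : (1 + η • vecMulVec v v).PosDef) {t : ℝ} (ht : 0 ≤ t) (hdet : IsUnit (S t).det) :
    S t = 1 + (η * (1 - Real.exp (-2 * t)) / (1 + η * Real.exp (-2 * t))) • vecMulVec v v := by
  have hW : vecMulVec v v * vecMulVec v v = vecMulVec v v := by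
    rw [vecMulVec_mul_vecMulVec, hv]; simp
  set W := vecMulVec v v
  set e := Real.exp (-2 * t)
  have he : 0 < e := Real.exp_pos _
  have hQi : (1 + η • W)⁻¹ = 1 - (η / (1 + η)) • W := by
    refine inv_eq_right_inv ?_
    simp only [add_mul, mul_sub, one_mul, mul_one, Matrix.smul_mul, Matrix.mul_smul, hW, smul_smul]
    have h1 : η - (η / (1 + η) + η / (1 + η) * η) = 0 := by field_simp; ring
    calc _ = 1 + (η - (η / (1 + η) + η / (1 + η) * η)) • W := by module
      _ = 1 := by rw [h1, zero_smul, add_zero]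
  have h := riccati_commuting PosDef.one hQ hS (by simp) ht
  rw [hQi] at h
  have h2 : (1 + (η * (1 - e) / (1 + η * e)) • W) * (S t)⁻¹ = 1 := by
    have h1 : η * (1 - e) / (1 + η * e) - (1 - e) * (η / (1 + η))
        - η * (1 - e) / (1 + η * e) * ((1 - e) * (η / (1 + η))) = 0 := by
      have : 1 + η * e ≠ 0 := by positivity
      field_simp
      ring
    rw [h, inv_one]
    simp only [add_mul, mul_sub, mul_add, one_mul, mul_one, Matrix.smul_mul, Matrix.mul_smul, hW,
      smul_smul, smul_sub]
    calc _ = 1 + (η * (1 - e) / (1 + η * e) - (1 - e) * (η / (1 + η))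
        - η * (1 - e) / (1 + η * e) * ((1 - e) * (η / (1 + η)))) • W := by module
      _ = 1 := by rw [h1, zero_smul, add_zero]
  calc S t = (1 + (η * (1 - e) / (1 + η * e)) • W) * (S t)⁻¹ * S t := by rw [h2, one_mul]
    _ = _ := by rw [Matrix.mul_assoc, nonsing_inv_mul _ hdet, mul_one]

end ClosedForm

/-! ### Gaussian measures and their densities -/

section Gaussian

variable {d : ℕ}

theorem dotProduct_self_eq_norm_sq (x : E d) : x.ofLp ⬝ᵥ x.ofLp = ‖x‖ ^ 2 := by
  rw [EuclideanSpace.real_norm_sq_eq, dotProduct]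
  simp [pow_two]

theorem gaussianDensity_one (x : E d) :
    gaussianDensity (1 : Matrix (Fin d) (Fin d) ℝ) x =
      (√((2 * Real.pi) ^ d))⁻¹ * Real.exp (-(1 / 2) * ‖x‖ ^ 2) := by
  simp [gaussianDensity, dotProduct_self_eq_norm_sq]

theorem contDiff_gaussianDensity (S : Matrix (Fin d) (Fin d) ℝ) :
    ContDiff ℝ ∞ (gaussianDensity S) := by
  unfold gaussianDensity
  have h : ContDiff ℝ ∞ fun x : E d => x.ofLp ⬝ᵥ (S⁻¹ *ᵥ x.ofLp) := by
    simp only [dotProduct, mulVec]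
    fun_prop
  fun_prop

theorem gaussianDensity_pos {S : Matrix (Fin d) (Fin d) ℝ} (hS : S.PosDef) (x : E d) :
    0 < gaussianDensity S x := by
  have := hS.det_pos
  unfold gaussianDensity
  positivity

theorem rpow_half_eq_sqrt_pow (a : ℝ) (ha : 0 ≤ a) : a ^ ((d : ℝ) / 2) = √(a ^ d) := by
  rw [Real.sqrt_eq_rpow, ← Real.rpow_natCast, ← Real.rpow_mul ha]
  congr 1
  ring

theorem integrable_gaussianDensity_one :
    Integrable (gaussianDensity (1 : Matrix (Fin d) (Fin d) ℝ)) := by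
  have h := (GaussianFourier.integrable_cexp_neg_mul_sq_norm_add (V := E d) (b := 1 / 2)
    (by norm_num) 0 0).re.const_mul (√((2 * Real.pi) ^ d))⁻¹
  refine h.congr (.of_forall fun x => ?_)
  have : -(1 / 2 : ℂ) * (‖x‖ : ℂ) ^ 2 + 0 * ((inner ℝ (0 : E d) x : ℝ) : ℂ)
      = ((-(1 / 2) * ‖x‖ ^ 2 : ℝ) : ℂ) := by push_cast; ring
  simp only [gaussianDensity_one, this]
  rw [← Complex.ofReal_exp]
  rfl

/-- Both measures have the same characteristic function. -/
theorem stdGaussian_eq_densityMeasure :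
    stdGaussian (E d) = densityMeasure (gaussianDensity (1 : Matrix (Fin d) (Fin d) ℝ)) := by
  have hfin : IsFiniteMeasure
      (densityMeasure (gaussianDensity (1 : Matrix (Fin d) (Fin d) ℝ))) :=
    isFiniteMeasure_withDensity_ofReal integrable_gaussianDensity_one.2
  refine Measure.ext_of_charFun ?_
  ext t
  rw [charFun_stdGaussian, charFun_apply, densityMeasure,
    integral_withDensity_eq_integral_toReal_smul
      ((contDiff_gaussianDensity 1).continuous.measurable.ennreal_ofReal) (by simp)]
  have h := GaussianFourier.integral_cexp_neg_mul_sq_norm_add (V := E d) (b := 1 / 2)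
    (by norm_num) Complex.I t
  have hc : (((√((2 * Real.pi) ^ d))⁻¹ : ℝ) : ℂ) *
      ((Real.pi / (1 / 2)) ^ ((Module.finrank ℝ (E d) : ℂ) / 2)) = 1 := by
    have h1 : ((Real.pi : ℂ) / (1 / 2)) ^ ((Module.finrank ℝ (E d) : ℂ) / 2)
        = ((√((2 * Real.pi) ^ d) : ℝ) : ℂ) := by
      rw [← rpow_half_eq_sqrt_pow _ (by positivity), Complex.ofReal_cpow (by positivity)]
      congr 1
      · push_cast; ring
      · simp
    rw [h1, ← Complex.ofReal_mul, inv_mul_cancel₀ (by positivity), Complex.ofReal_one]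
  calc _ = (((√((2 * Real.pi) ^ d))⁻¹ : ℝ) : ℂ) *
        ((Real.pi / (1 / 2)) ^ ((Module.finrank ℝ (E d) : ℂ) / 2) *
          Complex.exp (Complex.I ^ 2 * ‖t‖ ^ 2 / (4 * (1 / 2)))) := by
        rw [← mul_assoc, hc, one_mul, Complex.I_sq]
        congr 1
        ring
    _ = _ := by
        rw [← h, ← integral_const_mul]
        refine integral_congr_ae (.of_forall fun x => ?_)
        simp only []
        rw [ENNReal.toReal_ofReal (gaussianDensity_pos PosDef.one x).le, gaussianDensity_one,
          Complex.real_smul, Complex.ofReal_mul, mul_assoc, Complex.ofReal_exp, ← Complex.exp_add,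
          real_inner_comm]
        congr 2
        push_cast
        ring

theorem inner_matCLM (A : Matrix (Fin d) (Fin d) ℝ) (x y : E d) :
    inner ℝ x (matCLM A y) = x.ofLp ⬝ᵥ (A *ᵥ y.ofLp) := by
  simp [matCLM, inner_toEuclideanCLM]

theorem matCLM_mul_apply (A B : Matrix (Fin d) (Fin d) ℝ) (x : E d) :
    matCLM (A * B) x = matCLM A (matCLM B x) := by
  simp [matCLM]

theorem matCLM_sub_apply (A B : Matrix (Fin d) (Fin d) ℝ) (x : E d) :
    matCLM (A - B) x = matCLM A x - matCLM B x := by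
  simp [matCLM]

theorem matCLM_one_apply (x : E d) : matCLM 1 x = x := by simp [matCLM]

theorem inner_matCLM_left (A : Matrix (Fin d) (Fin d) ℝ) (x y : E d) :
    inner ℝ (matCLM A x) y = inner ℝ x (matCLM Aᵀ y) := by
  rw [real_inner_comm, inner_matCLM, inner_matCLM, dotProduct_mulVec, ← mulVec_transpose,
    dotProduct_comm]

theorem gaussianDensity_eq_inner (S : Matrix (Fin d) (Fin d) ℝ) (x : E d) :
    gaussianDensity S x =
      (√((2 * Real.pi) ^ d * S.det))⁻¹ * Real.exp (-(1 / 2) * inner ℝ x (matCLM S⁻¹ x)) := by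
  rw [inner_matCLM]; rfl

theorem det_matCLM (A : Matrix (Fin d) (Fin d) ℝ) :
    LinearMap.det (matCLM A : E d →ₗ[ℝ] E d) = A.det := by
  rw [matCLM, coe_toEuclideanCLM_eq_toEuclideanLin, toEuclideanLin, toLpLin_eq_toLin,
    LinearMap.det_toLin]

open scoped MatrixOrder in
/-- By definition the left-hand side is the image of the standard Gaussian under `√S`; so this is
the change of variables formula. -/
theorem multivariateGaussian_eq_densityMeasure {S : Matrix (Fin d) (Fin d) ℝ} (hS : S.PosDef) :
    multivariateGaussian 0 S = densityMeasure (gaussianDensity S) := by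
  set B := CFC.sqrt S with hB
  have hBB : B * B = S := CFC.sqrt_mul_sqrt_self S hS.posSemidef.nonneg
  have hBt : Bᵀ = B := by
    have := (CFC.sqrt_nonneg S).posSemidef.isHermitian
    rwa [Matrix.IsHermitian, conjTranspose_eq_transpose_of_trivial] at this
  have hdet : S.det = B.det ^ 2 := by rw [← hBB, det_mul, pow_two]
  have hBdet : B.det ≠ 0 := fun h => hS.det_pos.ne' (by rw [hdet, h]; simp)
  have hinv : B⁻¹ * B = 1 := nonsing_inv_mul _ hBdet.isUnit
  have hvol : Measure.map (matCLM B) (volume : Measure (E d)) =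
      ENNReal.ofReal |(B.det)⁻¹| • volume := by
    have := Measure.map_linearMap_addHaar_eq_smul_addHaar (volume : Measure (E d))
      (f := (matCLM B : E d →ₗ[ℝ] E d)) (by rwa [det_matCLM])
    rwa [det_matCLM] at this
  have hdens : ∀ x, gaussianDensity 1 x = |B.det| * gaussianDensity S (matCLM B x) := by
    intro x
    have he : B * S⁻¹ * B = 1 := by
      rw [Matrix.mul_assoc, ← hBB, Matrix.mul_inv_rev, Matrix.mul_assoc B⁻¹, hinv, mul_one,
        mul_nonsing_inv _ hBdet.isUnit]
    have hB0 : |B.det| ≠ 0 := abs_ne_zero.2 hBdet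
    rw [gaussianDensity_eq_inner S, gaussianDensity_one, inner_matCLM_left, hBt,
      ← matCLM_mul_apply, ← matCLM_mul_apply, he, hdet, Real.sqrt_mul (by positivity),
      Real.sqrt_sq_eq_abs, matCLM_one_apply, real_inner_self_eq_norm_sq]
    field_simp
  have h1 : multivariateGaussian 0 S = (stdGaussian (E d)).map (matCLM B) := by
    simp only [multivariateGaussian, zero_add]; rfl
  rw [h1, stdGaussian_eq_densityMeasure]
  ext A hA
  have hmeas : Measurable (gaussianDensity S) := (contDiff_gaussianDensity S).continuous.measurable
  have hLm : Measurable (matCLM B) := (matCLM B).continuous.measurable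
  rw [Measure.map_apply hLm hA, densityMeasure, densityMeasure, withDensity_apply _ (hLm hA),
    withDensity_apply _ hA]
  simp_rw [hdens, ENNReal.ofReal_mul (abs_nonneg B.det)]
  rw [lintegral_const_mul _ (by fun_prop),
    ← setLIntegral_map hA hmeas.ennreal_ofReal hLm, hvol, Measure.restrict_smul,
    lintegral_smul_measure, smul_eq_mul, ← mul_assoc, ← ENNReal.ofReal_mul (abs_nonneg _),
    abs_inv, mul_inv_cancel₀ (abs_ne_zero.2 hBdet), ENNReal.ofReal_one, one_mul]

theorem map_multivariateGaussian {S : Matrix (Fin d) (Fin d) ℝ} (hS : S.PosSemidef)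
    (A : Matrix (Fin d) (Fin d) ℝ) :
    (multivariateGaussian 0 S).map (matCLM A) = multivariateGaussian 0 (A * S * Aᵀ) := by
  have hS' : (A * S * Aᵀ).PosSemidef := by
    simpa [conjTranspose_eq_transpose_of_trivial] using hS.mul_mul_conjTranspose_same A
  have := Measure.isProbabilityMeasure_map (μ := multivariateGaussian 0 S)
    (matCLM A).continuous.aemeasurable
  refine Measure.ext_of_charFun ?_
  ext t
  rw [charFun_multivariateGaussian hS', charFun_apply,
    integral_map (by fun_prop) (by fun_prop)]
  simp_rw [inner_matCLM_left]
  rw [← charFun_apply, charFun_multivariateGaussian hS]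
  simp [← Matrix.mulVec_mulVec, dotProduct_mulVec, ← mulVec_transpose]

theorem integral_coord_multivariateGaussian (S : Matrix (Fin d) (Fin d) ℝ) (i : Fin d) :
    ∫ x : E d, x i ∂(multivariateGaussian 0 S) = 0 := by
  have := ContinuousLinearMap.integral_comp_id_comm (μ := multivariateGaussian 0 S)
    IsGaussian.integrable_id (EuclideanSpace.proj (𝕜 := ℝ) i)
  simpa using this

theorem integral_coord_mul_multivariateGaussian {S : Matrix (Fin d) (Fin d) ℝ}
    (hS : S.PosSemidef) (i j : Fin d) :
    ∫ x : E d, x i * x j ∂(multivariateGaussian 0 S) = S i j := by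
  rw [← covariance_eval_multivariateGaussian (μ := 0) hS i j, covariance]
  simp [integral_coord_multivariateGaussian]

end Gaussian

/-! ### The potential and the velocity field -/

section Velocity

variable {d : ℕ}

theorem transpose_of_posDef {Q : Matrix (Fin d) (Fin d) ℝ} (hQ : Q.PosDef) : Qᵀ = Q := by
  simpa [Matrix.IsHermitian, conjTranspose_eq_transpose_of_trivial] using hQ.isHermitian

theorem potential_gaussianDensity {Q : Matrix (Fin d) (Fin d) ℝ} (hQ : Q.PosDef) (x : E d) :
    potential (gaussianDensity Q) x =
      1 / 2 * inner ℝ x (matCLM Q⁻¹ x) + -Real.log (√((2 * Real.pi) ^ d * Q.det))⁻¹ := by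
  have := hQ.det_pos
  rw [potential, gaussianDensity_eq_inner, Real.log_mul (by positivity) (Real.exp_pos _).ne',
    Real.log_exp]
  ring

theorem hasGradientAt_inner_matCLM {A : Matrix (Fin d) (Fin d) ℝ} (hA : Aᵀ = A) (y : E d) :
    HasGradientAt (fun x : E d => inner ℝ x (matCLM A x)) ((2 : ℝ) • matCLM A y) y := by
  rw [hasGradientAt_iff_hasFDerivAt]
  refine ((hasFDerivAt_id y).inner ℝ (matCLM A).hasFDerivAt).congr_fderiv ?_
  ext v
  simp only [fderivInnerCLM_apply, ContinuousLinearMap.comp_apply, ContinuousLinearMap.prod_apply,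
    ContinuousLinearMap.id_apply, InnerProductSpace.toDual_apply_apply, inner_smul_left, id_eq]
  rw [real_inner_comm, inner_matCLM_left A v y, hA, inner_matCLM_left A y v, hA,
    real_inner_comm, inner_matCLM_left, hA]
  simp
  ring

theorem gradient_potential {Q : Matrix (Fin d) (Fin d) ℝ} (hQ : Q.PosDef) (y : E d) :
    gradient (potential (gaussianDensity Q)) y = matCLM Q⁻¹ y := by
  have h := ((hasGradientAt_iff_hasFDerivAt.1
    (hasGradientAt_inner_matCLM (transpose_of_posDef hQ.inv) y)).const_mul (1 / 2 : ℝ)).add_const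
    (-Real.log (√((2 * Real.pi) ^ d * Q.det))⁻¹)
  rw [funext (potential_gaussianDensity hQ)]
  refine HasGradientAt.gradient (hasGradientAt_iff_hasFDerivAt.2 (h.congr_fderiv ?_))
  ext v
  simp

/-- The potential of a Gaussian grows exactly quadratically, so integrability of `1 + |V|` means
finite second moments. The constant `C` is the sum of one that works for each inequality. -/
theorem exists_potential_bounds {Q : Matrix (Fin d) (Fin d) ℝ} (hQ : Q.PosDef) :
    ∃ C : ℝ, 0 ≤ C ∧ (∀ x, 1 + ‖x‖ ^ 2 ≤ C * (1 + |potential (gaussianDensity Q) x|)) ∧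
      ∀ x, 1 + |potential (gaussianDensity Q) x| ≤ C * (1 + ‖x‖ ^ 2) := by
  obtain ⟨B, hBu, hBt, hBQ⟩ := exists_symm_sqrt hQ.inv
  set κ := -Real.log (√((2 * Real.pi) ^ d * Q.det))⁻¹ with hκ
  have hV : ∀ x, potential (gaussianDensity Q) x = 1 / 2 * ‖matCLM B x‖ ^ 2 + κ := fun x => by
    rw [potential_gaussianDensity hQ, ← hBQ, matCLM_mul_apply, ← real_inner_self_eq_norm_sq,
      inner_matCLM_left, hBt]
  have h1 : ∀ x, ‖x‖ ≤ ‖matCLM B⁻¹‖ * ‖matCLM B x‖ := fun x => by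
    have : matCLM B⁻¹ (matCLM B x) = x := by
      rw [← matCLM_mul_apply, nonsing_inv_mul _ hBu, matCLM_one_apply]
    calc ‖x‖ = ‖matCLM B⁻¹ (matCLM B x)‖ := by rw [this]
      _ ≤ _ := ContinuousLinearMap.le_opNorm _ _
  have h2 : ∀ x, ‖matCLM B x‖ ≤ ‖matCLM B‖ * ‖x‖ := fun x => ContinuousLinearMap.le_opNorm _ _
  set b := ‖matCLM B‖
  set b' := ‖matCLM B⁻¹‖
  have hb : 0 ≤ b := norm_nonneg _
  have hb' : 0 ≤ b' := norm_nonneg _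
  refine ⟨(1 + 2 * b' ^ 2 * (1 + |κ|)) + (1 + b ^ 2 + |κ|), by positivity, fun x => ?_,
    fun x => ?_⟩
  · have h3 : ‖x‖ ^ 2 ≤ b' ^ 2 * ‖matCLM B x‖ ^ 2 := by
      rw [← mul_pow]; exact pow_le_pow_left₀ (norm_nonneg _) (h1 x) 2
    have h4 : ‖matCLM B x‖ ^ 2 ≤ 2 * (|potential (gaussianDensity Q) x| + |κ|) := by
      rw [hV]
      have := abs_sub_abs_le_abs_sub (1 / 2 * ‖matCLM B x‖ ^ 2) (-κ)
      rw [abs_neg, sub_neg_eq_add, abs_of_nonneg (by positivity)] at this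
      linarith
    have hp := abs_nonneg (potential (gaussianDensity Q) x)
    have hk := abs_nonneg κ
    set p := |potential (gaussianDensity Q) x|
    have h5 : ‖x‖ ^ 2 ≤ b' ^ 2 * (2 * (p + |κ|)) :=
      h3.trans (mul_le_mul_of_nonneg_left h4 (by positivity))
    have h6 : 0 ≤ b' ^ 2 * |κ| * p := by positivity
    have h7 : 0 ≤ (1 + b ^ 2 + |κ|) * (1 + p) := by positivity
    nlinarith [mul_nonneg (sq_nonneg b') hp]
  · have h3 : ‖matCLM B x‖ ^ 2 ≤ b ^ 2 * ‖x‖ ^ 2 := by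
      rw [← mul_pow]; exact pow_le_pow_left₀ (norm_nonneg _) (h2 x) 2
    have h4 : |potential (gaussianDensity Q) x| ≤ 1 / 2 * ‖matCLM B x‖ ^ 2 + |κ| := by
      rw [hV]
      refine (abs_add_le _ _).trans ?_
      rw [abs_of_nonneg (by positivity)]
    have hk := abs_nonneg κ
    have h5 : 0 ≤ (1 + 2 * b' ^ 2 * (1 + |κ|)) * (1 + ‖x‖ ^ 2) := by positivity
    nlinarith [mul_nonneg hk (sq_nonneg ‖x‖), mul_nonneg (sq_nonneg b) (sq_nonneg ‖x‖),
      sq_nonneg ‖x‖, sq_nonneg b]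

/-- The matrix `∫ x xᵀ dρ` of (non-centered) second moments. -/
noncomputable def secondMoment (ρ : Measure (E d)) : Matrix (Fin d) (Fin d) ℝ :=
  Matrix.of fun i j => ∫ x, x i * x j ∂ρ

/-- The mean `∫ x dρ`. -/
noncomputable def mean (ρ : Measure (E d)) : E d := ∫ x, x ∂ρ

theorem memLp_coord {ρ : Measure (E d)} (h : MemLp (fun x : E d => x) 2 ρ) (i : Fin d) :
    MemLp (fun x : E d => x i) 2 ρ :=
  (EuclideanSpace.proj (𝕜 := ℝ) i).comp_memLp' h

theorem integrable_inner_smul {ρ : Measure (E d)} (h : MemLp (fun x : E d => x) 2 ρ) (x : E d) :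
    Integrable (fun y : E d => (inner ℝ x y : ℝ) • y) ρ :=
  h.smul (p := 2) (q := 2) (r := 1) ((innerSL ℝ x).comp_memLp' h) |> memLp_one_iff_integrable.1

theorem integral_inner_smul {ρ : Measure (E d)} (h : MemLp (fun x : E d => x) 2 ρ) (x : E d) :
    ∫ y, (inner ℝ x y : ℝ) • y ∂ρ = matCLM (secondMoment ρ) x := by
  ext i
  have h1 := ContinuousLinearMap.integral_comp_comm (EuclideanSpace.proj (𝕜 := ℝ) i)
    (integrable_inner_smul h x)
  simp only [EuclideanSpace.coe_proj] at h1
  rw [← h1]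
  simp only [PiLp.smul_apply, smul_eq_mul, PiLp.inner_apply, matCLM, ofLp_toEuclideanCLM, mulVec,
    dotProduct, secondMoment, Matrix.of_apply, Finset.sum_mul]
  rw [integral_finsetSum]
  · refine Finset.sum_congr rfl fun j _ => ?_
    rw [← integral_mul_const]
    refine integral_congr_ae (.of_forall fun y => ?_)
    simp
    ring
  · intro j _
    have := ((memLp_coord h j).integrable_mul (memLp_coord h i)).const_mul (x j)
    refine this.congr (.of_forall fun y => ?_)
    simp
    ring

theorem integral_sub_inner_smul {ρ : Measure (E d)} [IsProbabilityMeasure ρ]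
    (h : MemLp (fun x : E d => x) 2 ρ) (A : Matrix (Fin d) (Fin d) ℝ) (w : E d) (c : ℝ) :
    ∫ y, (w - ((inner ℝ w y : ℝ) + c) • matCLM A y) ∂ρ =
      w - matCLM A (matCLM (secondMoment ρ) w + c • mean ρ) := by
  have h1 : Integrable (fun y : E d => c • y) ρ := (h.integrable (by norm_num)).smul c
  have h2 := integrable_inner_smul h w
  have h3 : Integrable (fun y : E d => (inner ℝ w y : ℝ) • y + c • y) ρ := h2.add h1
  simp only [← map_smul, add_smul]
  rw [integral_sub (integrable_const _) ((matCLM A).integrable_comp h3),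
    ContinuousLinearMap.integral_comp_comm _ h3, integral_add h2 h1, integral_inner_smul h,
    integral_smul]
  simp [mean]

theorem matCLM_vecMulVec (v z : E d) :
    matCLM (vecMulVec v.ofLp v.ofLp) z = (inner ℝ z v : ℝ) • v := by
  ext i
  simp [matCLM, vecMulVec_mulVec, PiLp.inner_apply, dotProduct, mul_comm]

/-- For both kernels the velocity field is affine, with coefficients that depend continuously on
the second moments and the mean. For centered measures it is `x ↦ (1 - Q⁻¹ M) x`. -/
theorem exists_velocity_coefficients {Q : Matrix (Fin d) (Fin d) ℝ} (hQ : Q.PosDef)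
    {K : MFKernel d} (hK : K = kernelOne d ∨ K = kernelTwo d) :
    ∃ β γ : Matrix (Fin d) (Fin d) ℝ × E d → Matrix (Fin d) (Fin d) ℝ,
      Continuous β ∧ Continuous γ ∧ (∀ M, β (M, 0) = 1 - Q⁻¹ * M) ∧
      ∀ (ρ : Measure (E d)) [IsProbabilityMeasure ρ], MemLp (fun x : E d => x) 2 ρ → ∀ x,
        svgdVelocity K (potential (gaussianDensity Q)) ρ x =
          matCLM (β (secondMoment ρ, mean ρ)) x + matCLM (γ (secondMoment ρ, mean ρ)) (mean ρ) := by
  rcases hK with rfl | rfl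
  · refine ⟨fun p => 1 - Q⁻¹ * p.1, fun _ => -Q⁻¹, by fun_prop, by fun_prop, fun _ => rfl, ?_⟩
    intro ρ _ hρ x
    have hg : ∀ y, gradient (fun z => kernelOne d ρ x z) y = x := fun y => by
      refine HasGradientAt.gradient ?_
      rw [hasGradientAt_iff_hasFDerivAt]
      exact ((innerSL ℝ x).hasFDerivAt (x := y)).add_const 1
    have h := integral_sub_inner_smul hρ Q⁻¹ x 1
    simp only [svgdVelocity, hg, gradient_potential hQ]
    refine h.trans ?_
    simp [matCLM]
    abel
  · -- here the covariance `M - m mᵀ` takes the place of the second moments `M`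
    refine ⟨fun p => 1 - Q⁻¹ * (p.1 - vecMulVec p.2.ofLp p.2.ofLp),
      fun p => -(1 - Q⁻¹ * (p.1 - vecMulVec p.2.ofLp p.2.ofLp) + Q⁻¹), by fun_prop, by fun_prop,
      fun M => by simp, ?_⟩
    intro ρ _ hρ x
    have hg : ∀ y, gradient (fun z => kernelTwo d ρ x z) y = x - mean ρ := fun y => by
      refine HasGradientAt.gradient ?_
      rw [hasGradientAt_iff_hasFDerivAt]
      exact ((innerSL ℝ (x - mean ρ)).hasFDerivAt.comp y
        ((hasFDerivAt_id y).sub_const (mean ρ))).add_const 1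
    have hk : ∀ y, kernelTwo d ρ x y =
        (inner ℝ (x - mean ρ) y : ℝ) + (1 - inner ℝ (x - mean ρ) (mean ρ)) := fun y => by
      change inner ℝ (x - mean ρ) (y - mean ρ) + 1 = _
      rw [inner_sub_right]
      ring
    have h := integral_sub_inner_smul hρ Q⁻¹ (x - mean ρ) (1 - inner ℝ (x - mean ρ) (mean ρ))
    simp only [svgdVelocity, hg, gradient_potential hQ]
    simp only [hk]
    refine h.trans ?_
    have hsub : matCLM (secondMoment ρ) (x - mean ρ) +
        (1 - inner ℝ (x - mean ρ) (mean ρ) : ℝ) • mean ρ =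
        matCLM (secondMoment ρ - vecMulVec (mean ρ).ofLp (mean ρ).ofLp) (x - mean ρ) + mean ρ := by
      rw [matCLM_sub_apply, matCLM_vecMulVec]
      module
    rw [hsub]
    generalize secondMoment ρ - vecMulVec (mean ρ).ofLp (mean ρ).ofLp = N
    simp [matCLM]
    abel

end Velocity

/-! ### Gaussian densities as classical solutions -/

section Classical

variable {d : ℕ}

theorem hasGradientAt_gaussianDensity {S : Matrix (Fin d) (Fin d) ℝ} (hS : S.PosDef) (y : E d) :
    HasGradientAt (gaussianDensity S) (-gaussianDensity S y • matCLM S⁻¹ y) y := by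
  have h := (((hasGradientAt_iff_hasFDerivAt.1
    (hasGradientAt_inner_matCLM (transpose_of_posDef hS.inv) y)).const_mul
      (-(1 / 2) : ℝ)).exp).const_mul (√((2 * Real.pi) ^ d * S.det))⁻¹
  rw [hasGradientAt_iff_hasFDerivAt, funext (gaussianDensity_eq_inner S)]
  refine h.congr_fderiv ?_
  ext v
  simp
  ring

theorem trace_eq_sum_inner (C : Matrix (Fin d) (Fin d) ℝ) :
    ∑ i, (matCLM C (EuclideanSpace.single i 1)) i = C.trace := by
  simp [matCLM, Matrix.trace]

/-- The divergence of `x ↦ p(x) C x` for a Gaussian density `p`. -/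
theorem divergence_gaussianDensity_smul {S : Matrix (Fin d) (Fin d) ℝ} (hS : S.PosDef)
    (C : Matrix (Fin d) (Fin d) ℝ) (x : E d) :
    divergence (fun x => gaussianDensity S x • matCLM C x) x =
      gaussianDensity S x * (C.trace - inner ℝ (matCLM S⁻¹ x) (matCLM C x)) := by
  have h := ((hasGradientAt_iff_hasFDerivAt.1 (hasGradientAt_gaussianDensity hS x)).smul
    (matCLM C).hasFDerivAt)
  have h' : fderiv ℝ (fun x => gaussianDensity S x • matCLM C x) x = _ := h.fderiv
  rw [divergence, h']
  simp only [_root_.add_apply, _root_.smul_apply, PiLp.add_apply,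
    PiLp.smul_apply, smul_eq_mul, ContinuousLinearMap.smulRight_apply, Finset.sum_add_distrib,
    ← Finset.mul_sum, trace_eq_sum_inner, InnerProductSpace.toDual_apply_apply]
  rw [mul_sub, sub_eq_add_neg, PiLp.inner_apply, ← mul_neg, ← Finset.sum_neg_distrib,
    Finset.mul_sum]
  congr 1
  refine Finset.sum_congr rfl fun i _ => ?_
  simp [inner_smul_left, EuclideanSpace.inner_single_right]
  ring

theorem integral_gaussianDensity_smul {S : Matrix (Fin d) (Fin d) ℝ} (hS : S.PosDef)
    (F : E d → E d) :
    ∫ y, gaussianDensity S y • F y = ∫ y, F y ∂(multivariateGaussian 0 S) := by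
  rw [multivariateGaussian_eq_densityMeasure hS, densityMeasure,
    integral_withDensity_eq_integral_toReal_smul
      ((contDiff_gaussianDensity S).continuous.measurable.ennreal_ofReal) (by simp)]
  simp_rw [ENNReal.toReal_ofReal (gaussianDensity_pos hS _).le]

theorem integrable_gaussianDensity_smul_iff {S : Matrix (Fin d) (Fin d) ℝ} (hS : S.PosDef)
    {G : Type*} [NormedAddCommGroup G] [NormedSpace ℝ G] (F : E d → G) :
    Integrable (fun y => gaussianDensity S y • F y) ↔
      Integrable F (multivariateGaussian 0 S) := by
  rw [multivariateGaussian_eq_densityMeasure hS, densityMeasure,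
    integrable_withDensity_iff_integrable_smul'
      ((contDiff_gaussianDensity S).continuous.measurable.ennreal_ofReal) (by simp)]
  simp_rw [ENNReal.toReal_ofReal (gaussianDensity_pos hS _).le]

theorem memLp_two_multivariateGaussian (S : Matrix (Fin d) (Fin d) ℝ) :
    MemLp (fun x : E d => x) 2 (multivariateGaussian 0 S) := IsGaussian.memLp_id _ 2 (by simp)

theorem secondMoment_multivariateGaussian {S : Matrix (Fin d) (Fin d) ℝ} (hS : S.PosSemidef) :
    secondMoment (multivariateGaussian 0 S) = S := by
  ext i j
  exact integral_coord_mul_multivariateGaussian hS i j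

theorem mean_multivariateGaussian (S : Matrix (Fin d) (Fin d) ℝ) :
    mean (multivariateGaussian 0 S) = 0 := integral_id_multivariateGaussian

/-- For a centered Gaussian the two kernels agree. -/
theorem flux_integrand {Q S : Matrix (Fin d) (Fin d) ℝ} (hQ : Q.PosDef) (hS : S.PosDef)
    {K : MFKernel d} (hK : K = kernelOne d ∨ K = kernelTwo d) (x y : E d) :
    K (densityMeasure (gaussianDensity S)) x y • (gradient (gaussianDensity S) y +
      gaussianDensity S y • gradient (potential (gaussianDensity Q)) y) =
    gaussianDensity S y • (((inner ℝ x y : ℝ) + 1) • matCLM (Q⁻¹ - S⁻¹) y) := by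
  have hk : K (densityMeasure (gaussianDensity S)) x y = inner ℝ x y + 1 := by
    rcases hK with rfl | rfl
    · rfl
    · rw [← multivariateGaussian_eq_densityMeasure hS, kernelTwo, integral_id_multivariateGaussian]
      simp
  rw [hk, (hasGradientAt_gaussianDensity hS y).gradient, gradient_potential hQ]
  rw [matCLM_sub_apply]
  module

theorem integrable_flux_integrand {S : Matrix (Fin d) (Fin d) ℝ}
    (A : Matrix (Fin d) (Fin d) ℝ) (x : E d) :
    Integrable (fun y => ((inner ℝ x y : ℝ) + 1) • matCLM A y) (multivariateGaussian 0 S) := by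
  have h := memLp_two_multivariateGaussian S
  have h1 := (integrable_inner_smul h x).add (h.integrable (by norm_num))
  refine ((matCLM A).integrable_comp h1).congr (.of_forall fun y => ?_)
  simp [add_smul]

/-- Since `∫ (xᵀ y + 1) A y dN(0, S)(y) = A S x`, the flux at a centered Gaussian density is that
density times a linear vector field. -/
theorem svgdFlux_gaussianDensity {Q S : Matrix (Fin d) (Fin d) ℝ} (hQ : Q.PosDef) (hS : S.PosDef)
    {K : MFKernel d} (hK : K = kernelOne d ∨ K = kernelTwo d) :
    svgdFlux K (potential (gaussianDensity Q)) (gaussianDensity S) =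
      fun x => gaussianDensity S x • matCLM (Q⁻¹ * S - 1) x := by
  ext1 x
  rw [svgdFlux]
  congr 1
  simp_rw [flux_integrand hQ hS hK]
  have h := integral_sub_inner_smul (memLp_two_multivariateGaussian S) (Q⁻¹ - S⁻¹) x 1
  rw [integral_sub (integrable_const _) (integrable_flux_integrand _ _)] at h
  simp only [integral_const, probReal_univ, one_smul, mean_multivariateGaussian, add_zero,
    secondMoment_multivariateGaussian hS.posSemidef] at h
  rw [integral_gaussianDensity_smul hS, sub_right_injective h, ← matCLM_mul_apply, sub_mul,
    nonsing_inv_mul _ hS.det_pos.ne'.isUnit]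

open scoped Matrix.Norms.Frobenius in
theorem hasDerivWithinAt_matCLM {A : ℝ → Matrix (Fin d) (Fin d) ℝ}
    {A' : Matrix (Fin d) (Fin d) ℝ} {s : Set ℝ} {t : ℝ} (h : HasDerivWithinAt A A' s t) :
    HasDerivWithinAt (fun r => matCLM (A r)) (matCLM A') s t :=
  (toEuclideanCLM (n := Fin d) (𝕜 := ℝ)).toAlgEquiv.toLinearMap.toContinuousLinearMap
    |>.hasFDerivAt.comp_hasDerivWithinAt t h

open scoped Matrix.Norms.Frobenius in
/-- The derivative of the determinant, from Jacobi's formula, gives the trace term and that of the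
inverse gives the quadratic form. -/
theorem hasDerivWithinAt_gaussianDensity {S : ℝ → Matrix (Fin d) (Fin d) ℝ}
    {S' : Matrix (Fin d) (Fin d) ℝ} {s : Set ℝ} {t : ℝ} (hS : (S t).PosDef)
    (h : HasDerivWithinAt S S' s t) (x : E d) :
    HasDerivWithinAt (fun r => gaussianDensity (S r) x)
      (gaussianDensity (S t) x * (-(1 / 2) * ((S t)⁻¹ * S').trace +
        1 / 2 * inner ℝ x (matCLM ((S t)⁻¹ * S' * (S t)⁻¹) x))) s t := by
  have hd := hS.det_pos
  have hq : HasDerivWithinAt (fun r => inner ℝ x (matCLM (S r)⁻¹ x))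
      (-inner ℝ x (matCLM ((S t)⁻¹ * S' * (S t)⁻¹) x)) s t := by
    have h1 := hasDerivWithinAt_matrix_inv h hS.isUnit
    have h2 := (hasDerivWithinAt_const t s x).inner ℝ
      ((hasDerivWithinAt_matCLM h1).clm_apply (hasDerivWithinAt_const t s x))
    refine h2.congr_deriv ?_
    simp [matCLM]
  have hdet : HasDerivWithinAt (fun r => (√((2 * Real.pi) ^ d * (S r).det))⁻¹)
      ((√((2 * Real.pi) ^ d * (S t).det))⁻¹ * (-(1 / 2) * ((S t)⁻¹ * S').trace)) s t := by
    have h1 := (((hasDerivWithinAt_det h).const_mul ((2 * Real.pi) ^ d)).sqrt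
      (by positivity)).inv (by positivity)
    refine h1.congr_deriv ?_
    have h2 : ((S t).adjugate * S').trace = (S t).det * ((S t)⁻¹ * S').trace := by
      rw [Matrix.inv_def, Ring.inverse_eq_inv', Matrix.smul_mul, trace_smul, smul_eq_mul,
        mul_inv_cancel_left₀ hd.ne']
    rw [h2, Real.sq_sqrt (by positivity)]
    field_simp
  simp only [gaussianDensity_eq_inner]
  refine (hdet.mul ((hq.const_mul (-(1 / 2))).exp)).congr_deriv ?_
  ring

/-- Along the Riccati equation the time derivative of the Gaussian density equals the divergence of
the flux: both are the density times a quadratic polynomial, and the traces and quadratic forms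
agree. -/
theorem isClassicalSolution_gaussian {Q S₀ : Matrix (Fin d) (Fin d) ℝ} (hQ : Q.PosDef)
    {S : ℝ → Matrix (Fin d) (Fin d) ℝ} (hS : IsRiccatiSolution Q S₀ S)
    (hpos : ∀ t, 0 ≤ t → (S t).PosDef)
    {K : MFKernel d} (hK : K = kernelOne d ∨ K = kernelTwo d) :
    IsClassicalSolution K (potential (gaussianDensity Q)) (gaussianDensity S₀)
      (fun t => gaussianDensity (S t)) where
  initial := by simp only [hS.initial]
  smooth t _ := contDiff_gaussianDensity _
  nonneg t ht x := (gaussianDensity_pos (hpos t ht) x).le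
  integrable t ht := by
    have := (integrable_gaussianDensity_smul_iff (hpos t ht) (fun _ => (1 : ℝ))).2
      (integrable_const _)
    simpa using this
  mass_one t ht := by
    rw [integral_eq_lintegral_of_nonneg_ae
      (.of_forall fun x => (gaussianDensity_pos (hpos t ht) x).le)
      (contDiff_gaussianDensity _).continuous.aestronglyMeasurable]
    have h1 : densityMeasure (gaussianDensity (S t)) univ = 1 := by
      rw [← multivariateGaussian_eq_densityMeasure (hpos t ht), measure_univ]
    rw [densityMeasure, withDensity_apply _ MeasurableSet.univ, Measure.restrict_univ] at h1
    rw [h1, ENNReal.toReal_one]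
  integrable_flux t ht x := by
    simp_rw [flux_integrand hQ (hpos t ht) hK]
    exact (integrable_gaussianDensity_smul_iff (hpos t ht) _).2 (integrable_flux_integrand _ _)
  differentiable_flux t ht := by
    rw [svgdFlux_gaussianDensity hQ (hpos t ht) hK]
    exact ((contDiff_gaussianDensity _).differentiable (by simp)).smul (matCLM _).differentiable
  equation t ht x := by
    rw [svgdFlux_gaussianDensity hQ (hpos t ht) hK, divergence_gaussianDensity_smul (hpos t ht)]
    refine (hasDerivWithinAt_gaussianDensity (hpos t ht) (hS.equation t ht) x).congr_deriv ?_
    congr 1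
    have hu : IsUnit (S t).det := (hpos t ht).det_pos.ne'.isUnit
    have hi : (S t)⁻¹ * S t = 1 := nonsing_inv_mul _ hu
    have hi' : S t * (S t)⁻¹ = 1 := mul_nonsing_inv _ hu
    have hSt := transpose_of_posDef (hpos t ht).inv
    have hQt := transpose_of_posDef hQ.inv
    have e1 : (S t)⁻¹ * ((2 : ℝ) • S t - S t ^ 2 * Q⁻¹ - Q⁻¹ * S t ^ 2) =
        (2 : ℝ) • 1 - S t * Q⁻¹ - (S t)⁻¹ * Q⁻¹ * S t * S t := by
      rw [mul_sub, mul_sub, Matrix.mul_smul, hi, pow_two, ← Matrix.mul_assoc, ← Matrix.mul_assoc,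
        hi, one_mul]
      simp only [Matrix.mul_assoc]
    have e2 : (S t)⁻¹ * ((2 : ℝ) • S t - S t ^ 2 * Q⁻¹ - Q⁻¹ * S t ^ 2) * (S t)⁻¹ =
        (2 : ℝ) • (S t)⁻¹ - S t * Q⁻¹ * (S t)⁻¹ - (S t)⁻¹ * Q⁻¹ * S t := by
      rw [e1, sub_mul, sub_mul, Matrix.smul_mul, one_mul, Matrix.mul_assoc _ (S t) (S t)⁻¹, hi',
        mul_one]
    have h3 : (S t * Q⁻¹).trace = (Q⁻¹ * S t).trace := trace_mul_comm _ _
    have h4 : ((S t)⁻¹ * Q⁻¹ * S t * S t).trace = (Q⁻¹ * S t).trace := by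
      rw [Matrix.mul_assoc, Matrix.mul_assoc, trace_mul_comm, Matrix.mul_assoc, Matrix.mul_assoc,
        hi', mul_one]
    have h5 : inner ℝ x (matCLM (S t * Q⁻¹ * (S t)⁻¹) x) =
        inner ℝ x (matCLM ((S t)⁻¹ * Q⁻¹ * S t) x) := by
      rw [real_inner_comm, inner_matCLM_left]
      simp only [transpose_mul, hSt, hQt, transpose_of_posDef (hpos t ht), Matrix.mul_assoc]
    have h6 : inner ℝ (matCLM (S t)⁻¹ x) (matCLM (Q⁻¹ * S t - 1) x) =
        inner ℝ x (matCLM ((S t)⁻¹ * Q⁻¹ * S t) x) - inner ℝ x (matCLM (S t)⁻¹ x) := by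
      rw [inner_matCLM_left, hSt, ← matCLM_mul_apply, mul_sub, matCLM_sub_apply, inner_sub_right,
        mul_one, Matrix.mul_assoc]
    have h7 : inner ℝ x (matCLM ((2 : ℝ) • (S t)⁻¹) x) = 2 * inner ℝ x (matCLM (S t)⁻¹ x) := by
      simp [matCLM, inner_smul_right]
    rw [e2, e1, h6, matCLM_sub_apply, matCLM_sub_apply, inner_sub_right, inner_sub_right, h5, h7,
      trace_sub, trace_sub, trace_sub, h3, h4, trace_smul, smul_eq_mul]
    ring

end Classical

/-! ### Gaussian curves as weak solutions -/

section WeakExistence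

variable {d : ℕ}

/-- The derivative of a test function along a curve that passes through `x` at time `t` with
velocity `u`. -/
theorem deriv_add_inner_gradient {φ : ℝ × E d → ℝ} (hφ : Differentiable ℝ φ) (t : ℝ) (x u : E d) :
    deriv (fun s => φ (s, x)) t + inner ℝ (gradient (fun z => φ (t, z)) x) u =
      fderiv ℝ φ (t, x) (1, u) := by
  have h1 : HasDerivAt (fun s => φ (s, x)) (fderiv ℝ φ (t, x) (1, 0)) t :=
    (hφ (t, x)).hasFDerivAt.comp_hasDerivAt t ((hasDerivAt_id t).prodMk (hasDerivAt_const t x))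
  have h2 : HasFDerivAt (fun z => φ (t, z))
      ((fderiv ℝ φ (t, x)).comp (ContinuousLinearMap.inr ℝ ℝ (E d))) x :=
    (hφ (t, x)).hasFDerivAt.comp x
      ((hasFDerivAt_const t x).prodMk (hasFDerivAt_id x))
  rw [h1.deriv, gradient, InnerProductSpace.toDual_symm_apply, h2.fderiv,
    ContinuousLinearMap.comp_apply, ContinuousLinearMap.inr_apply, ← map_add]
  simp

open scoped Matrix.Norms.Frobenius in
/-- The image of a measure under the flow of a linear velocity field satisfies the continuity
equation: integrate `d/dt φ(t, Φ(t) x)` over time and then over `x`. -/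
theorem weak_equation_of_flow {ν : Measure (E d)} [IsProbabilityMeasure ν]
    {Φ A : ℝ → Matrix (Fin d) (Fin d) ℝ} (h0 : Φ 0 = 1)
    (hΦ : ∀ t, 0 ≤ t → HasDerivWithinAt Φ (A t * Φ t) (Ici 0) t) (hA : ContinuousOn A (Ici 0))
    {φ : ℝ × E d → ℝ} (hφ : ContDiff ℝ ∞ φ) (hc : HasCompactSupport φ) :
    (∫ t in Ioi 0, ∫ x, fderiv ℝ φ (t, matCLM (Φ t) x) (1, matCLM (A t) (matCLM (Φ t) x)) ∂ν)
      + ∫ x, φ (0, x) ∂ν = 0 := by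
  set D : ℝ × E d → ℝ := fun p =>
    fderiv ℝ φ (p.1, matCLM (Φ p.1) p.2) (1, matCLM (A p.1) (matCLM (Φ p.1) p.2)) with hD
  have hφd : Differentiable ℝ φ := hφ.differentiable (by simp)
  have hΦc : ContinuousOn Φ (Ici 0) := fun t ht => (hΦ t ht).continuousWithinAt
  have hDc : ContinuousOn D (Ici 0 ×ˢ univ) := by
    have hf : ContinuousOn (fun p : ℝ × E d => p.1) (Ici 0 ×ˢ univ) := continuousOn_fst
    have h1 : ContinuousOn (fun p : ℝ × E d => matCLM (Φ p.1) p.2) (Ici 0 ×ˢ univ) :=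
      (continuous_matCLM.comp_continuousOn (hΦc.comp hf fun p hp => hp.1)).clm_apply
        continuousOn_snd
    have h2 : ContinuousOn (fun p : ℝ × E d => matCLM (A p.1) (matCLM (Φ p.1) p.2))
        (Ici 0 ×ˢ univ) :=
      (continuous_matCLM.comp_continuousOn (hA.comp hf fun p hp => hp.1)).clm_apply h1
    exact ((hφ.continuous_fderiv (by simp)).comp_continuousOn (hf.prodMk h1)).clm_apply
      (continuousOn_const.prodMk h2)
  obtain ⟨R, hR⟩ : ∃ R : ℝ, tsupport φ ⊆ Metric.closedBall 0 R :=
    hc.isCompact.isBounded.subset_closedBall 0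
  have hzero : ∀ p, p ∉ Metric.closedBall (0 : ℝ × E d) R → fderiv ℝ φ p = 0 := fun p hp =>
    image_eq_zero_of_notMem_tsupport fun h => hp (hR (tsupport_fderiv_subset ℝ h))
  obtain ⟨C₁, hC₁⟩ := (hc.fderiv ℝ).exists_bound_of_continuous (hφ.continuous_fderiv (by simp))
  obtain ⟨C₂, hC₂⟩ := isCompact_Icc.exists_bound_of_continuousOn
    ((continuous_matCLM.comp_continuousOn hA).mono (Icc_subset_Ici_self : Icc 0 R ⊆ Ici 0))
  have hbound : ∀ p : ℝ × E d, 0 ≤ p.1 →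
      ‖D p‖ ≤ (Icc 0 R).indicator (fun _ => C₁ * (1 + C₂ * R)) p.1 := by
    intro p hp
    by_cases hm : (p.1, matCLM (Φ p.1) p.2) ∈ Metric.closedBall (0 : ℝ × E d) R
    · rw [mem_closedBall_zero_iff, Prod.norm_def, max_le_iff] at hm
      have hpR : p.1 ∈ Icc 0 R := ⟨hp, (le_abs_self _).trans hm.1⟩
      rw [indicator_of_mem hpR]
      refine (ContinuousLinearMap.le_opNorm _ _).trans ?_
      have hC₁0 : 0 ≤ C₁ := (norm_nonneg _).trans (hC₁ 0)
      have hC₂0 : 0 ≤ C₂ := (norm_nonneg _).trans (hC₂ _ hpR)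
      have hR0 : 0 ≤ R := hpR.1.trans hpR.2
      refine mul_le_mul (hC₁ _) ?_ (norm_nonneg _) hC₁0
      have h3 : ‖matCLM (A p.1) (matCLM (Φ p.1) p.2)‖ ≤ C₂ * R :=
        (ContinuousLinearMap.le_opNorm _ _).trans
          (mul_le_mul (hC₂ _ hpR) hm.2 (norm_nonneg _) hC₂0)
      rw [Prod.norm_def, max_le_iff]
      constructor
      · simpa using by positivity
      · linarith
    · have : D p = 0 := by simp only [hD, hzero _ hm]; simp
      rw [this, norm_zero]
      refine indicator_nonneg (fun s hs => ?_) _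
      have hC₁0 : 0 ≤ C₁ := (norm_nonneg _).trans (hC₁ 0)
      have hC₂0 : 0 ≤ C₂ := (norm_nonneg _).trans (hC₂ s hs)
      have hR0 : 0 ≤ R := hs.1.trans hs.2
      positivity
  -- the bound depends on time only and `ν` is finite, so that the integrals can be exchanged
  have hint : Integrable D ((volume.restrict (Ioi 0)).prod ν) := by
    have hg : Integrable ((Icc 0 R).indicator fun _ => C₁ * (1 + C₂ * R))
        (volume.restrict (Ioi (0 : ℝ))) :=
      (integrable_indicator_iff measurableSet_Icc).2
        (integrableOn_const (by
          exact ((Measure.restrict_apply_le _ _).trans_lt measure_Icc_lt_top).ne))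
    refine Integrable.mono' (hg.comp_fst ν) ?_ ?_
    · have h1 : (volume.restrict (Ioi (0 : ℝ))).prod ν =
          (volume.prod ν).restrict (Ioi 0 ×ˢ univ) := by
        rw [← Measure.prod_restrict, Measure.restrict_univ]
      rw [h1]
      exact (hDc.mono (prod_mono Ioi_subset_Ici_self subset_rfl)).aestronglyMeasurable
        (measurableSet_Ioi.prod MeasurableSet.univ)
    · have h1 : ∀ᵐ p ∂((volume.restrict (Ioi (0 : ℝ))).prod ν), 0 < p.1 :=
        Measure.quasiMeasurePreserving_fst.ae (ae_restrict_mem measurableSet_Ioi)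
      filter_upwards [h1] with p hp using hbound p hp.le
  have hswap := integral_integral_swap (f := fun t x => D (t, x)) hint
  change (∫ t in Ioi 0, ∫ x, D (t, x) ∂ν) + _ = 0
  rw [hswap, ← integral_add]
  · refine (integral_congr_ae ?_).trans (integral_zero _ _)
    filter_upwards [hint.prod_left_ae] with x hx
    have hF : ∀ t, 0 ≤ t → HasDerivWithinAt (fun s => φ (s, matCLM (Φ s) x)) (D (t, x))
        (Ici 0) t := fun t ht => by
      have h1 := (hasDerivWithinAt_matCLM (hΦ t ht)).clm_apply (hasDerivWithinAt_const t (Ici 0) x)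
      have h2 := (hφd (t, matCLM (Φ t) x)).hasFDerivAt.comp_hasDerivWithinAt t
        ((hasDerivWithinAt_id t (Ici 0)).prodMk h1)
      refine h2.congr_deriv ?_
      simp [hD, matCLM]
    have h3 := integral_Ioi_of_hasDerivAt_of_tendsto (hF 0 le_rfl).continuousWithinAt
      (fun t ht => (hF t (le_of_lt ht)).hasDerivAt (Ici_mem_nhds ht)) hx (m := 0) (by
        refine tendsto_const_nhds.congr' ?_
        filter_upwards [Filter.eventually_gt_atTop R] with t ht
        refine (image_eq_zero_of_notMem_tsupport fun h => ?_).symm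
        have := hR h
        rw [mem_closedBall_zero_iff, Prod.norm_def, max_le_iff] at this
        exact absurd ((le_abs_self t).trans this.1) (not_le.2 ht))
    rw [h3, h0, matCLM_one_apply]
    simp
  · exact hint.integral_prod_right
  · have : Continuous fun x => φ (0, x) := hφ.continuous.comp (by fun_prop)
    refine Integrable.of_bound this.aestronglyMeasurable
      (hc.exists_bound_of_continuous hφ.continuous).choose (.of_forall fun x => ?_)
    exact (hc.exists_bound_of_continuous hφ.continuous).choose_spec _

end WeakExistence

section WeakSolution

variable {d : ℕ}

theorem integrable_one_add_norm_sq {ν : Measure (E d)} [IsProbabilityMeasure ν]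
    (h : MemLp (fun x : E d => x) 2 ν) (C M : ℝ) :
    Integrable (fun x => C * (1 + M * ‖x‖ ^ 2)) ν :=
  ((integrable_const 1).add ((h.integrable_norm_pow (by norm_num)).const_mul M)).const_mul C

open scoped Matrix.Norms.Frobenius in
/-- The curve consists of the images of `N(0, S₀)` under the linear flow `Φ`, whose velocity field is
`svgdVelocity` at these images. Bounds and continuity are inherited from the continuity of `Φ`. -/
theorem isWeakSolution_gaussian {Q S₀ : Matrix (Fin d) (Fin d) ℝ} (hS₀ : S₀.PosDef)
    (hQ : Q.PosDef) {Φ Ψ : ℝ → Matrix (Fin d) (Fin d) ℝ} (h0 : Φ 0 = 1)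
    (hΨ : ∀ t, 0 ≤ t → Ψ t * Φ t = 1)
    (hΦ : ∀ t, 0 ≤ t → HasDerivWithinAt Φ ((1 - Q⁻¹ * (Φ t * S₀ * (Φ t)ᵀ)) * Φ t) (Ici 0) t)
    {K : MFKernel d} (hK : K = kernelOne d ∨ K = kernelTwo d) :
    IsWeakSolution K (potential (gaussianDensity Q)) (multivariateGaussian 0 S₀)
      (fun t => multivariateGaussian 0 (Φ t * S₀ * (Φ t)ᵀ)) := by
  obtain ⟨C, hC, hC₁, hC₂⟩ := exists_potential_bounds hQ
  have hmap : ∀ t, multivariateGaussian 0 (Φ t * S₀ * (Φ t)ᵀ) =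
      (multivariateGaussian 0 S₀).map (matCLM (Φ t)) := fun t =>
    (map_multivariateGaussian hS₀.posSemidef (Φ t)).symm
  have hΦc : ContinuousOn Φ (Ici 0) := fun t ht => (hΦ t ht).continuousWithinAt
  have hLc : ContinuousOn (fun t => matCLM (Φ t)) (Ici 0) :=
    continuous_matCLM.comp_continuousOn hΦc
  have hmom := memLp_two_multivariateGaussian S₀
  have hVc : Continuous (potential (gaussianDensity Q)) := by
    rw [funext (potential_gaussianDensity hQ)]
    fun_prop
  have hsq : ∀ (t : ℝ) (M : ℝ), ‖matCLM (Φ t)‖ ≤ M → ∀ x : E d,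
      1 + ‖matCLM (Φ t) x‖ ^ 2 ≤ 1 + M ^ 2 * ‖x‖ ^ 2 := by
    intro t M hM x
    rw [← mul_pow]
    have := (ContinuousLinearMap.le_opNorm (matCLM (Φ t)) x).trans
      (mul_le_mul_of_nonneg_right hM (norm_nonneg x))
    gcongr
  refine ⟨by simp [h0], fun t _ => inferInstance, fun T => ?_, fun f hf hfb => ?_,
    fun φ hφ hc => ?_⟩
  · obtain ⟨M, hM⟩ := isCompact_Icc.exists_bound_of_continuousOn
      (hLc.mono (Icc_subset_Ici_self : Icc 0 T ⊆ Ici 0))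
    have hfin := (integrable_one_add_norm_sq hmom C (M ^ 2)).lintegral_lt_top
    refine ⟨(∫⁻ x, ENNReal.ofReal (C * (1 + M ^ 2 * ‖x‖ ^ 2))
      ∂(multivariateGaussian 0 S₀)).toNNReal, fun t ht => ?_⟩
    rw [hmap, lintegral_map (by fun_prop) (by fun_prop), ENNReal.coe_toNNReal hfin.ne]
    refine lintegral_mono fun x => ENNReal.ofReal_le_ofReal ?_
    exact (hC₂ _).trans (mul_le_mul_of_nonneg_left (hsq t M (hM t ht) x) hC)
  · obtain ⟨B, hB⟩ := hfb
    simp only [hmap]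
    have hint : ∀ t, ∫ x, f x ∂((multivariateGaussian 0 S₀).map (matCLM (Φ t))) =
        ∫ x, f (matCLM (Φ t) x) ∂(multivariateGaussian 0 S₀) := fun t =>
      integral_map (by fun_prop) hf.aestronglyMeasurable
    simp only [hint]
    intro t ht
    have hnear : ∀ᶠ s in nhdsWithin t (Ici 0), ‖matCLM (Φ s)‖ ≤ ‖matCLM (Φ t)‖ + 1 :=
      ((hLc t ht).norm).eventually_le_const (lt_add_one _)
    refine continuousWithinAt_of_dominated
      (bound := fun x => (|B| * C) * (1 + (‖matCLM (Φ t)‖ + 1) ^ 2 * ‖x‖ ^ 2))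
      (.of_forall fun s => (hf.comp (matCLM (Φ s)).continuous).aestronglyMeasurable) ?_
      (integrable_one_add_norm_sq hmom _ _) (.of_forall fun x => ?_)
    · filter_upwards [hnear] with s hs
      refine .of_forall fun x => ?_
      have hp : 0 ≤ 1 + |potential (gaussianDensity Q) (matCLM (Φ s) x)| := by positivity
      calc ‖f (matCLM (Φ s) x)‖
          ≤ B * (1 + |potential (gaussianDensity Q) (matCLM (Φ s) x)|) := hB _
        _ ≤ |B| * (1 + |potential (gaussianDensity Q) (matCLM (Φ s) x)|) :=
            mul_le_mul_of_nonneg_right (le_abs_self B) hp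
        _ ≤ |B| * (C * (1 + ‖matCLM (Φ s) x‖ ^ 2)) :=
            mul_le_mul_of_nonneg_left (hC₂ _) (abs_nonneg B)
        _ ≤ |B| * (C * (1 + (‖matCLM (Φ t)‖ + 1) ^ 2 * ‖x‖ ^ 2)) := by
            gcongr _ * (_ * ?_)
            exact hsq s _ hs x
        _ = _ := by ring
    · exact hf.continuousAt.comp_continuousWithinAt
        ((hLc t ht).clm_apply continuousWithinAt_const)
  · have hφd : Differentiable ℝ φ := hφ.differentiable (by simp)
    obtain ⟨β, γ, -, -, hβ, hU⟩ := exists_velocity_coefficients hQ hK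
    have hvel : ∀ t, 0 ≤ t → ∀ x, svgdVelocity K (potential (gaussianDensity Q))
        (multivariateGaussian 0 (Φ t * S₀ * (Φ t)ᵀ)) x =
          matCLM (1 - Q⁻¹ * (Φ t * S₀ * (Φ t)ᵀ)) x := fun t ht x => by
      rw [hU _ (memLp_two_multivariateGaussian _), mean_multivariateGaussian,
        secondMoment_multivariateGaussian (posDef_congr_of_left_inverse hS₀ (hΨ t ht)).posSemidef,
        hβ, map_zero, add_zero]
    refine Eq.trans ?_ (weak_equation_of_flow (ν := multivariateGaussian 0 S₀) h0 hΦ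
      (continuousOn_flow_coefficient hΦc) hφ hc)
    congr 1
    refine setIntegral_congr_fun (measurableSet_Ioi (a := (0 : ℝ))) fun t ht => ?_
    simp only [hvel t (le_of_lt ht), deriv_add_inner_gradient hφd]
    rw [hmap, integral_map (by fun_prop)]
    have := hφ.continuous_fderiv (by simp)
    refine Continuous.aestronglyMeasurable ?_
    fun_prop

end WeakSolution

/-! ### Weak derivatives and weak convergence -/

section Tools

theorem exists_primitive_Ici {G : Type*} [NormedAddCommGroup G] [NormedSpace ℝ G]
    [CompleteSpace G] {f : ℝ → G} (hf : ContinuousOn f (Ici 0)) :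
    ∃ F : ℝ → G, F 0 = 0 ∧ Continuous F ∧
      ∀ t, 0 ≤ t → HasDerivWithinAt F (f t) (Ici 0) t := by
  have hc : Continuous fun t => f (max t 0) :=
    hf.comp_continuous (by fun_prop) fun t => mem_Ici.2 (le_max_right t 0)
  refine ⟨fun t => ∫ s in (0 : ℝ)..t, f (max s 0), intervalIntegral.integral_same,
    continuous_iff_continuousAt.2 fun t =>
      (hc.integral_hasStrictDerivAt 0 t).hasDerivAt.continuousAt, fun t ht => ?_⟩
  have := (hc.integral_hasStrictDerivAt 0 t).hasDerivAt.hasDerivWithinAt (s := Ici 0)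
  rwa [max_eq_left ht] at this

/-- A test function on `ℝ` extended from its derivative on `[0, ∞)`: it is the antiderivative that
vanishes near infinity, cut off on the negative axis. -/
theorem exists_antideriv_Ici {η : ℝ → ℝ} (hη : ContDiff ℝ ∞ η) (hc : HasCompactSupport η) :
    ∃ χ : ℝ → ℝ, ContDiff ℝ ∞ χ ∧ HasCompactSupport χ ∧ ∀ t, 0 ≤ t → deriv χ t = η t := by
  obtain ⟨R, hR⟩ : ∃ R : ℝ, tsupport η ⊆ Metric.closedBall 0 R :=
    hc.isCompact.isBounded.subset_closedBall 0
  have hzero : ∀ t, |R| < t → η t = 0 := fun t ht => image_eq_zero_of_notMem_tsupport fun h => by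
    have h1 := mem_closedBall_zero_iff.1 (hR h)
    exact absurd ((le_abs_self t).trans (h1.trans (le_abs_self R))) (not_le.2 ht)
  set X : ℝ → ℝ := fun t => ∫ s in (|R| + 1)..t, η s with hX
  have hXd : ∀ t, HasDerivAt X (η t) t := fun t =>
    (hη.continuous.integral_hasStrictDerivAt _ t).hasDerivAt
  have hXs : ContDiff ℝ ∞ X := by
    rw [contDiff_infty_iff_deriv]
    refine ⟨fun t => (hXd t).differentiableAt, ?_⟩
    rwa [funext fun t => (hXd t).deriv]
  have hX0 : ∀ t, |R| < t → X t = 0 := fun t ht => by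
    refine (intervalIntegral.integral_congr (g := fun _ => 0) fun s hs => hzero s ?_).trans
      (by simp)
    exact (lt_min (lt_add_one _) ht).trans_le hs.1
  let b : ContDiffBump (0 : ℝ) := ⟨|R| + 2, |R| + 3, by positivity, by linarith⟩
  refine ⟨fun t => b t * X t, b.contDiff.mul hXs, b.hasCompactSupport.mul_right, fun t ht => ?_⟩
  rcases lt_or_ge |R| t with h | h
  · have : (fun t => b t * X t) =ᶠ[nhds t] fun _ => 0 := by
      filter_upwards [Ioi_mem_nhds h] with s hs
      rw [hX0 s hs, mul_zero]
    rw [this.deriv_eq, hzero t h, deriv_const]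
  · have : (fun t => b t * X t) =ᶠ[nhds t] X := by
      have ht' : t ∈ Metric.ball (0 : ℝ) (|R| + 2) := by
        rw [mem_ball_zero_iff, Real.norm_of_nonneg ht]; linarith
      filter_upwards [Metric.isOpen_ball.mem_nhds ht'] with s hs
      rw [b.one_of_mem_closedBall (Metric.ball_subset_closedBall hs), one_mul]
    rw [this.deriv_eq, (hXd t).deriv]

/-- A continuous function on `[0, ∞)` with a continuous weak derivative is differentiable. -/
theorem hasDerivWithinAt_of_weak_deriv {g h : ℝ → ℝ} (hg : ContinuousOn g (Ici 0))
    (hh : ContinuousOn h (Ici 0))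
    (hw : ∀ χ : ℝ → ℝ, ContDiff ℝ ∞ χ → HasCompactSupport χ →
      (∫ t in Ioi 0, (deriv χ t * g t + χ t * h t)) + χ 0 * g 0 = 0) :
    ∀ t, 0 ≤ t → HasDerivWithinAt g (h t) (Ici 0) t := by
  obtain ⟨H, hH0, hHc, hH⟩ := exists_primitive_Ici hh
  -- `k = g - H - g 0` has weak derivative `0`; the boundary term in `hw` shows that the constant to
  -- which it is equal is `0`
  set k : ℝ → ℝ := fun t => g (max t 0) - H t - g 0 with hk
  have hgc : Continuous fun t => g (max t 0) :=
    hg.comp_continuous (by fun_prop) fun t => mem_Ici.2 (le_max_right t 0)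
  have hkc : Continuous k := (hgc.sub hHc).sub continuous_const
  have hint : ∀ (η f : ℝ → ℝ), Continuous η → HasCompactSupport η → ContinuousOn f (Ici 0) →
      IntegrableOn (fun t => η t * f t) (Ioi 0) := by
    intro η f hη hc hf
    have hfc : Continuous fun t => f (max t 0) :=
      hf.comp_continuous (by fun_prop) fun t => mem_Ici.2 (le_max_right t 0)
    have : Integrable fun t => η t * f (max t 0) :=
      (hη.mul hfc).integrable_of_hasCompactSupport hc.mul_right
    refine this.integrableOn.congr_fun (fun t ht => ?_) measurableSet_Ioi
    simp [max_eq_left (le_of_lt (show (0 : ℝ) < t from ht))]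
  have hae : ∀ᵐ t ∂(volume.restrict (Ioi (0 : ℝ))), k t = 0 := by
    refine ae_eq_zero_of_integral_contDiff_smul_eq_zero
      (hkc.locallyIntegrable (μ := volume.restrict (Ioi 0))) fun η hη hηc => ?_
    obtain ⟨χ, hχ, hχc, hχη⟩ := exists_antideriv_Ici hη hηc
    have hχd : Continuous (deriv χ) := hχ.continuous_deriv (by simp)
    have h1 := hw χ hχ hχc
    have h2 : ∫ t in Ioi 0, (deriv χ t * H t + χ t * h t) = 0 := by
      have h3 := integral_Ioi_of_hasDerivAt_of_tendsto (a := 0) (m := 0)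
        (f := fun t => χ t * H t) (f' := fun t => deriv χ t * H t + χ t * h t)
        (hχ.continuous.mul hHc).continuousWithinAt
        (fun t ht => ((hχ.differentiable (by simp) t).hasDerivAt).mul
          ((hH t (le_of_lt ht)).hasDerivAt (Ici_mem_nhds ht)))
        ((hint _ _ hχd hχc.deriv hHc.continuousOn).add (hint _ _ hχ.continuous hχc hh))
        ((hχc.mul_right (f' := H)).is_zero_at_infty.mono_left atTop_le_cocompact)
      simpa [hH0] using h3
    have h4 : ∫ t in Ioi 0, deriv χ t = -χ 0 :=
      hχc.integral_Ioi_deriv_eq (hχ.of_le (by simp)) 0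
    have i1 := hint _ _ hχd hχc.deriv hg
    have i2 := hint _ _ hχd hχc.deriv hHc.continuousOn
    have i3 := hint _ _ hχ.continuous hχc hh
    have i4 : IntegrableOn (fun t => deriv χ t * g 0) (Ioi 0) :=
      hint _ (fun _ => g 0) hχd hχc.deriv continuousOn_const
    have i12 : IntegrableOn (fun t => deriv χ t * g t - deriv χ t * H t) (Ioi 0) := i1.sub i2
    rw [integral_add i1 i3] at h1
    rw [integral_add i2 i3] at h2
    calc ∫ t in Ioi 0, η t • k t
        = ∫ t in Ioi 0, (deriv χ t * g t - deriv χ t * H t - deriv χ t * g 0) := by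
          refine setIntegral_congr_fun measurableSet_Ioi fun t ht => ?_
          have ht0 : (0 : ℝ) ≤ t := le_of_lt ht
          simp only [hk, hχη t ht0, max_eq_left ht0, smul_eq_mul]
          ring
      _ = 0 := by
          rw [integral_sub i12 i4, integral_sub i1 i2, integral_mul_const, h4]
          linarith
  have hk0 : ∀ t, 0 < t → k t = 0 := fun t ht =>
    Measure.eqOn_open_of_ae_eq (g := fun _ => 0) hae isOpen_Ioi hkc.continuousOn
      continuousOn_const ht
  have heq : ∀ t, 0 ≤ t → g t = H t + g 0 := by
    intro t ht
    rcases ht.eq_or_lt with rfl | ht'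
    · rw [hH0, zero_add]
    · have := hk0 t ht'
      simp only [hk, max_eq_left ht] at this
      linarith
  exact fun t ht => ((hH t ht).add_const (g 0)).congr (fun s hs => heq s hs) (heq t ht)

/-- A finite measure on a finite-dimensional space is determined by the integrals of the test
functions: these determine its density with respect to any measure that dominates it. -/
theorem ext_of_integral_test_function {F : Type*} [NormedAddCommGroup F] [NormedSpace ℝ F]
    [FiniteDimensional ℝ F] [MeasurableSpace F] [BorelSpace F] {μ ν : Measure F}
    [IsFiniteMeasure μ] [IsFiniteMeasure ν]
    (h : ∀ ψ : F → ℝ, ContDiff ℝ ∞ ψ → HasCompactSupport ψ → ∫ x, ψ x ∂μ = ∫ x, ψ x ∂ν) :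
    μ = ν := by
  have hμ : μ ≪ μ + ν := Measure.absolutelyContinuous_of_le (Measure.le_add_right le_rfl)
  have hν : ν ≪ μ + ν := Measure.absolutelyContinuous_of_le (Measure.le_add_left le_rfl)
  have dμ : μ.HaveLebesgueDecomposition (μ + ν) :=
    Measure.haveLebesgueDecomposition_of_sigmaFinite μ (μ + ν)
  have dν : ν.HaveLebesgueDecomposition (μ + ν) :=
    Measure.haveLebesgueDecomposition_of_sigmaFinite ν (μ + ν)
  have iμ : Integrable (fun x => (μ.rnDeriv (μ + ν) x).toReal) (μ + ν) :=
    Measure.integrable_toReal_rnDeriv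
  have iν : Integrable (fun x => (ν.rnDeriv (μ + ν) x).toReal) (μ + ν) :=
    Measure.integrable_toReal_rnDeriv
  have hae : ∀ᵐ x ∂(μ + ν), (μ.rnDeriv (μ + ν) x).toReal = (ν.rnDeriv (μ + ν) x).toReal := by
    refine ae_eq_of_integral_contDiff_smul_eq iμ.locallyIntegrable iν.locallyIntegrable
      fun ψ hψ hc => ?_
    have h1 := integral_rnDeriv_smul (f := ψ) hμ
    have h2 := integral_rnDeriv_smul (f := ψ) hν
    simp only [smul_eq_mul, mul_comm] at h1 h2 ⊢
    rw [h1, h2, h ψ hψ hc]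
  rw [← Measure.withDensity_rnDeriv_eq μ (μ + ν) hμ]
  refine Eq.trans ?_ (Measure.withDensity_rnDeriv_eq ν (μ + ν) hν)
  refine withDensity_congr_ae ?_
  filter_upwards [hae, Measure.rnDeriv_lt_top μ (μ + ν), Measure.rnDeriv_lt_top ν (μ + ν)]
    with x hx h1 h2
  exact (ENNReal.toReal_eq_toReal_iff' h1.ne h2.ne).1 hx

/-- Integrals converge if the integrands converge uniformly and the measures converge on the limit
of the integrands. -/
theorem tendsto_integral_of_uniform {α ι : Type*} [MeasurableSpace α] {ρ : ι → Measure α}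
    {l : Filter ι} {F : ι → α → ℝ} {F₀ : α → ℝ} {c : ℝ}
    (hρ : ∀ᶠ s in l, IsProbabilityMeasure (ρ s)) (hF : ∀ᶠ s in l, Integrable (F s) (ρ s))
    (hF₀ : ∀ᶠ s in l, Integrable F₀ (ρ s))
    (hunif : ∀ ε > 0, ∀ᶠ s in l, ∀ x, |F s x - F₀ x| ≤ ε)
    (hlim : Filter.Tendsto (fun s => ∫ x, F₀ x ∂(ρ s)) l (nhds c)) :
    Filter.Tendsto (fun s => ∫ x, F s x ∂(ρ s)) l (nhds c) := by
  have h : Filter.Tendsto (fun s => ∫ x, F s x ∂(ρ s) - ∫ x, F₀ x ∂(ρ s)) l (nhds 0) := by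
    rw [Metric.tendsto_nhds]
    intro ε hε
    filter_upwards [hρ, hF, hF₀, hunif (ε / 2) (by positivity)] with s h1 h2 h3 h4
    rw [dist_zero_right, ← integral_sub h2 h3]
    refine (norm_integral_le_of_norm_le_const (.of_forall h4)).trans_lt ?_
    simp
    linarith
  simpa using h.add hlim

/-- A jointly continuous family of functions with supports in a common compact set is uniformly
continuous in the parameter. -/
theorem eventually_uniform_of_compact_support {d : ℕ} {F : ℝ → E d → ℝ} {T : ℝ} {k : Set (E d)}
    (hF : ContinuousOn (Function.uncurry F) (Ici 0 ×ˢ univ)) (hk : IsCompact k)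
    (hzero : ∀ s ∈ Icc 0 T, ∀ x, x ∉ k → F s x = 0) {t : ℝ} (ht : t ∈ Ico 0 T) {ε : ℝ}
    (hε : 0 < ε) : ∀ᶠ s in nhdsWithin t (Ici 0), ∀ x, |F s x - F t x| ≤ ε := by
  obtain ⟨v, hv, hvF⟩ := hk.mem_uniformity_of_prod
    (hF.mono (prod_mono subset_rfl (subset_univ k))) (show t ∈ Ici 0 from ht.1)
    (Metric.dist_mem_uniformity hε)
  have : Iio T ∈ nhdsWithin t (Ici 0) := mem_nhdsWithin_of_mem_nhds (Iio_mem_nhds ht.2)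
  filter_upwards [hv, this, self_mem_nhdsWithin] with s hs hsT hs0 x
  by_cases hx : x ∈ k
  · exact le_of_lt (hvF s hs x hx)
  · rw [hzero s ⟨hs0, le_of_lt hsT⟩ x hx, hzero t ⟨ht.1, ht.2.le⟩ x hx]
    simpa using hε.le

end Tools

/-! ### Uniqueness for the continuity equation with an affine velocity field -/

section Transport

variable {d : ℕ}

open scoped Matrix.Norms.Frobenius

theorem continuousOn_affine {B : ℝ → Matrix (Fin d) (Fin d) ℝ} {b : ℝ → E d}
    (hB : ContinuousOn B (Ici 0)) (hb : ContinuousOn b (Ici 0)) :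
    ContinuousOn (fun p : ℝ × E d => matCLM (B p.1) p.2 + b p.1) (Ici 0 ×ˢ univ) := by
  have hf : ContinuousOn (fun p : ℝ × E d => p.1) (Ici 0 ×ˢ univ) := continuousOn_fst
  exact ((continuous_matCLM.comp_continuousOn (hB.comp hf fun p hp => hp.1)).clm_apply
    continuousOn_snd).add (hb.comp hf fun p hp => hp.1)

theorem gradient_const_mul_inner {ψ : E d → ℝ} (hψ : Differentiable ℝ ψ) (c : ℝ) (x u : E d) :
    inner ℝ (gradient (fun z => c * ψ z) x) u = c * fderiv ℝ ψ x u := by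
  rw [gradient, InnerProductSpace.toDual_symm_apply, fderiv_const_mul (hψ x)]
  rfl

/-- Testing a weak solution with products `χ(t) ψ(x)` shows that `∫ ψ dρ(t)` is continuously
differentiable in time. -/
theorem hasDerivWithinAt_integral_of_weak {K : MFKernel d} {V : E d → ℝ} {ν : Measure (E d)}
    {ρ : ℝ → Measure (E d)} (hρ : IsWeakSolution K V ν ρ)
    {B : ℝ → Matrix (Fin d) (Fin d) ℝ} {b : ℝ → E d}
    (hB : ContinuousOn B (Ici 0)) (hb : ContinuousOn b (Ici 0))
    (hU : ∀ t, 0 ≤ t → ∀ x, svgdVelocity K V (ρ t) x = matCLM (B t) x + b t)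
    (hcont : ∀ f : E d → ℝ, Continuous f → HasCompactSupport f →
      ContinuousOn (fun t => ∫ x, f x ∂(ρ t)) (Ici 0))
    {ψ : E d → ℝ} (hψ : ContDiff ℝ ∞ ψ) (hc : HasCompactSupport ψ) :
    ∀ t, 0 ≤ t → HasDerivWithinAt (fun s => ∫ x, ψ x ∂(ρ s))
      (∫ x, fderiv ℝ ψ x (matCLM (B t) x + b t) ∂(ρ t)) (Ici 0) t := by
  have hψd : Differentiable ℝ ψ := hψ.differentiable (by simp)
  have hfd : Continuous (fderiv ℝ ψ) := hψ.continuous_fderiv (by simp)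
  set F : ℝ → E d → ℝ := fun t x => fderiv ℝ ψ x (matCLM (B t) x + b t) with hF
  have hzero : ∀ t x, x ∉ tsupport ψ → F t x = 0 := fun t x hx => by
    have : fderiv ℝ ψ x = 0 := image_eq_zero_of_notMem_tsupport fun h =>
      hx (tsupport_fderiv_subset ℝ h)
    simp [hF, this]
  have hFc : ∀ t, Continuous (F t) := fun t => by
    have : Continuous fun x => matCLM (B t) x + b t := by fun_prop
    exact hfd.clm_apply this
  have hFs : ∀ t, HasCompactSupport (F t) := fun t => HasCompactSupport.intro hc (hzero t)
  have hFj : ContinuousOn (Function.uncurry F) (Ici 0 ×ˢ univ) :=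
    (hfd.comp_continuousOn continuousOn_snd).clm_apply (continuousOn_affine hB hb)
  have hFint : ∀ s t, 0 ≤ s → Integrable (F t) (ρ s) := fun s t hs =>
    have := hρ.probability s hs
    (hFc t).integrable_of_hasCompactSupport (hFs t)
  have hψint : ∀ s, 0 ≤ s → Integrable ψ (ρ s) := fun s hs =>
    have := hρ.probability s hs
    hψ.continuous.integrable_of_hasCompactSupport hc
  refine hasDerivWithinAt_of_weak_deriv (hcont ψ hψ.continuous hc)
    (h := fun t => ∫ x, F t x ∂(ρ t)) (fun t ht => ?_) fun χ hχ hχc => ?_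
  · have hself : ∀ᶠ s in nhdsWithin t (Ici 0), (0 : ℝ) ≤ s := self_mem_nhdsWithin
    refine tendsto_integral_of_uniform (hself.mono hρ.probability)
      (hself.mono fun s hs => hFint s s hs) (hself.mono fun s hs => hFint s t hs)
      (fun ε hε => eventually_uniform_of_compact_support (T := t + 1) hFj hc
        (fun s _ => hzero s) ⟨ht, lt_add_one t⟩ hε) (hcont (F t) (hFc t) (hFs t) t ht)
  · have h1 := hρ.equation (fun p => χ p.1 * ψ p.2)
      ((hχ.comp contDiff_fst).mul (hψ.comp contDiff_snd))
      (HasCompactSupport.intro (hχc.isCompact.prod hc.isCompact) fun p hp => by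
        rw [mem_prod, not_and_or] at hp
        rcases hp with hp | hp <;> simp [image_eq_zero_of_notMem_tsupport hp])
    refine Eq.trans ?_ h1
    rw [hρ.initial, ← integral_const_mul]
    congr 1
    refine setIntegral_congr_fun (measurableSet_Ioi (a := (0 : ℝ))) fun t ht => ?_
    have ht0 : (0 : ℝ) ≤ t := le_of_lt ht
    have hd : ∀ x, deriv (fun s => χ s * ψ x) t = deriv χ t * ψ x := fun x =>
      deriv_mul_const (hχ.differentiable (by simp) t) _
    simp only [hd, gradient_const_mul_inner hψd, hU t ht0]
    rw [integral_add ((hψint t ht0).const_mul _) ((hFint t t ht0).const_mul _),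
      integral_const_mul, integral_const_mul]

/-- Let `Y(t) x = Ψ(t) x + c(t)` be the inverse of the flow of the velocity field
`x ↦ B(t) x + b(t)`. Then `d/dt ∫ ψ(Y(t) x) dρ(t) = 0` for every test function `ψ`, so the image of
`ρ(t)` under `Y(t)` does not depend on `t`. As `Y` is only continuously differentiable in time,
`ψ(Y(t) x)` itself is not an admissible test function on space-time; the difference quotient is
split into one in which only the integrand changes and one in which only the measure changes. -/
theorem map_inverse_flow_eq {ρ : ℝ → Measure (E d)}
    (hprob : ∀ t, 0 ≤ t → IsProbabilityMeasure (ρ t))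
    {B : ℝ → Matrix (Fin d) (Fin d) ℝ} {b : ℝ → E d}
    (hB : ContinuousOn B (Ici 0)) (hb : ContinuousOn b (Ici 0))
    (hcont : ∀ f : E d → ℝ, Continuous f → HasCompactSupport f →
      ContinuousOn (fun t => ∫ x, f x ∂(ρ t)) (Ici 0))
    (hweak : ∀ ψ : E d → ℝ, ContDiff ℝ ∞ ψ → HasCompactSupport ψ → ∀ t, 0 ≤ t →
      HasDerivWithinAt (fun s => ∫ x, ψ x ∂(ρ s))
        (∫ x, fderiv ℝ ψ x (matCLM (B t) x + b t) ∂(ρ t)) (Ici 0) t)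
    {Φ Ψ : ℝ → Matrix (Fin d) (Fin d) ℝ} {c : ℝ → E d}
    (hΦ : ContinuousOn Φ (Ici 0)) (hΨ0 : Ψ 0 = 1) (hc0 : c 0 = 0)
    (hΨ : ∀ t, 0 ≤ t → HasDerivWithinAt Ψ (-(Ψ t * B t)) (Ici 0) t)
    (hc : ∀ t, 0 ≤ t → HasDerivWithinAt c (-matCLM (Ψ t) (b t)) (Ici 0) t)
    (hΨΦ : ∀ t, 0 ≤ t → Ψ t * Φ t = 1) {t : ℝ} (ht : 0 ≤ t) :
    (ρ t).map (fun x => matCLM (Ψ t) x + c t) = ρ 0 := by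
  have hΨc : ContinuousOn Ψ (Ici 0) := fun t ht => (hΨ t ht).continuousWithinAt
  have hcc : ContinuousOn c (Ici 0) := fun t ht => (hc t ht).continuousWithinAt
  set Y : ℝ → E d → E d := fun t x => matCLM (Ψ t) x + c t with hY
  have hYc : ∀ t, Continuous (Y t) := fun t => by fun_prop
  have hYs : ∀ t, ContDiff ℝ ∞ (Y t) := fun t => by fun_prop
  have := hprob t ht
  have := hprob 0 le_rfl
  have := Measure.isProbabilityMeasure_map (μ := ρ t) (hYc t).aemeasurable
  refine ext_of_integral_test_function fun ψ hψ hψc => ?_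
  rw [integral_map (hYc t).aemeasurable hψ.continuous.aestronglyMeasurable]
  have hψd : Differentiable ℝ ψ := hψ.differentiable (by simp)
  have hfd : Continuous (fderiv ℝ ψ) := hψ.continuous_fderiv (by simp)
  -- the supports of `ψ ∘ Y s`, for `s` in a bounded interval, lie in a common ball
  have hsupp : ∀ T : ℝ, ∃ R : ℝ, ∀ s ∈ Icc 0 T, ∀ x, x ∉ Metric.closedBall (0 : E d) R →
      Y s x ∉ tsupport ψ := by
    intro T
    obtain ⟨R, hR⟩ := hψc.isCompact.isBounded.subset_closedBall 0
    obtain ⟨M₁, hM₁⟩ := isCompact_Icc.exists_bound_of_continuousOn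
      ((continuous_matCLM.comp_continuousOn hΦ).mono (Icc_subset_Ici_self : Icc 0 T ⊆ Ici 0))
    obtain ⟨M₂, hM₂⟩ := isCompact_Icc.exists_bound_of_continuousOn
      (hcc.mono (Icc_subset_Ici_self : Icc 0 T ⊆ Ici 0))
    refine ⟨M₁ * (R + M₂), fun s hs x hx hm => hx ?_⟩
    have h1 : matCLM (Φ s) (Y s x - c s) = x := by
      simp only [hY, add_sub_cancel_right]
      rw [← matCLM_mul_apply, mul_eq_one_comm.1 (hΨΦ s hs.1), matCLM_one_apply]
    rw [mem_closedBall_zero_iff, ← h1]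
    refine (ContinuousLinearMap.le_opNorm _ _).trans ?_
    have h2 := mem_closedBall_zero_iff.1 (hR hm)
    exact mul_le_mul (hM₁ s hs) ((norm_sub_le _ _).trans (add_le_add h2 (hM₂ s hs)))
      (norm_nonneg _) ((norm_nonneg _).trans (hM₁ s hs))
  have hcs : ∀ s, 0 ≤ s → HasCompactSupport fun x => ψ (Y s x) := fun s hs => by
    obtain ⟨R, hR⟩ := hsupp s
    exact HasCompactSupport.intro (isCompact_closedBall 0 R) fun x hx =>
      image_eq_zero_of_notMem_tsupport (hR s ⟨hs, le_rfl⟩ x hx)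
  -- the time derivative of `ψ (Y s x)`
  set D : ℝ → E d → ℝ := fun s x =>
    fderiv ℝ ψ (Y s x) (-matCLM (Ψ s) (matCLM (B s) x + b s)) with hD
  have hDd : ∀ x s, 0 ≤ s → HasDerivWithinAt (fun r => ψ (Y r x)) (D s x) (Ici 0) s := by
    intro x s hs
    have h1 := ((hasDerivWithinAt_matCLM (hΨ s hs)).clm_apply
      (hasDerivWithinAt_const s (Ici 0) x)).add (hc s hs)
    refine ((hψd (Y s x)).hasFDerivAt.comp_hasDerivWithinAt s h1).congr_deriv ?_
    simp only [hD, map_zero, add_zero]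
    congr 1
    simp [matCLM]
    abel
  have hYj : ContinuousOn (fun p : ℝ × E d => Y p.1 p.2) (Ici 0 ×ˢ univ) :=
    continuousOn_affine hΨc hcc
  have hDj : ContinuousOn (Function.uncurry D) (Ici 0 ×ˢ univ) := by
    have hf : ContinuousOn (fun p : ℝ × E d => p.1) (Ici 0 ×ˢ univ) := continuousOn_fst
    exact (hfd.comp_continuousOn hYj).clm_apply
      ((continuous_matCLM.comp_continuousOn (hΨc.comp hf fun p hp => hp.1)).clm_apply
        (continuousOn_affine hB hb)).neg
  have hDc : ∀ s, 0 ≤ s → Continuous (D s) := fun s hs =>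
    continuousOn_univ.1 (hDj.comp (f := fun x => (s, x)) (by fun_prop) fun x _ => ⟨hs, mem_univ _⟩)
  have hDzero : ∀ s x, Y s x ∉ tsupport ψ → D s x = 0 := fun s x hx => by
    have : fderiv ℝ ψ (Y s x) = 0 := image_eq_zero_of_notMem_tsupport fun h =>
      hx (tsupport_fderiv_subset ℝ h)
    simp [hD, this]
  have hDcs : ∀ s, 0 ≤ s → HasCompactSupport (D s) := fun s hs => by
    obtain ⟨R, hR⟩ := hsupp s
    exact HasCompactSupport.intro (isCompact_closedBall 0 R) fun x hx =>
      hDzero s x (hR s ⟨hs, le_rfl⟩ x hx)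
  have hψi : ∀ r s, 0 ≤ r → 0 ≤ s → Integrable (fun x => ψ (Y s x)) (ρ r) := fun r s hr hs =>
    have := hprob r hr
    (hψ.continuous.comp (hYc s)).integrable_of_hasCompactSupport (hcs s hs)
  have hDi : ∀ r s, 0 ≤ r → 0 ≤ s → Integrable (D s) (ρ r) := fun r s hr hs =>
    have := hprob r hr
    (hDc s hs).integrable_of_hasCompactSupport (hDcs s hs)
  have key : ∀ s, 0 ≤ s → HasDerivWithinAt (fun r => ∫ x, ψ (Y r x) ∂(ρ r)) 0 (Ici 0) s := by
    intro s hs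
    obtain ⟨R, hR⟩ := hsupp (s + 1)
    have hDunif : ∀ ε > 0, ∀ᶠ r in nhdsWithin s (Ici 0), ∀ x, |D r x - D s x| ≤ ε :=
      fun ε hε => eventually_uniform_of_compact_support (T := s + 1) hDj
        (isCompact_closedBall (0 : E d) R) (fun r hr x hx => hDzero r x (hR r hr x hx))
        ⟨hs, lt_add_one s⟩ hε
    -- by the mean value inequality the difference quotients converge uniformly as well
    have hquot : ∀ ε > 0, ∀ᶠ r in nhdsWithin s (Ici 0 \ {s}), ∀ x,
        |(r - s)⁻¹ * (ψ (Y r x) - ψ (Y s x)) - D s x| ≤ ε := by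
      intro ε hε
      obtain ⟨δ, hδ, hball⟩ := Metric.mem_nhdsWithin_iff.1 (hDunif ε hε)
      have hnear : ∀ᶠ r in nhdsWithin s (Ici 0 \ {s}), r ∈ Metric.ball s δ :=
        mem_nhdsWithin_of_mem_nhds (Metric.ball_mem_nhds s hδ)
      filter_upwards [hnear, self_mem_nhdsWithin] with r hr hr' x
      have hne : r - s ≠ 0 := sub_ne_zero.2 hr'.2
      have hconv : Convex ℝ (Metric.ball s δ ∩ Ici 0) := (convex_ball s δ).inter (convex_Ici 0)
      have hmv := hconv.norm_image_sub_le_of_norm_hasDerivWithin_le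
        (f := fun r => ψ (Y r x) - r * D s x) (f' := fun r => D r x - D s x) (C := ε)
        (fun q hq => ((hDd x q hq.2).mono inter_subset_right).sub
          (by simpa using (hasDerivWithinAt_id q _).mul_const (D s x)))
        (fun q hq => hball hq x) ⟨Metric.mem_ball_self hδ, hs⟩ ⟨hr, hr'.1⟩
      have he : (r - s)⁻¹ * (ψ (Y r x) - ψ (Y s x)) - D s x =
          (r - s)⁻¹ * ((ψ (Y r x) - r * D s x) - (ψ (Y s x) - s * D s x)) := by
        field_simp
        ring
      rw [he, abs_mul, abs_inv]
      rw [Real.norm_eq_abs, Real.norm_eq_abs] at hmv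
      rw [inv_mul_le_iff₀ (abs_pos.2 hne)]
      exact hmv.trans_eq (mul_comm _ _)
    have hself : ∀ᶠ r in nhdsWithin s (Ici 0 \ {s}), (0 : ℝ) ≤ r :=
      Filter.mem_of_superset self_mem_nhdsWithin fun r hr => hr.1
    have h1 : Filter.Tendsto
        (fun r => ∫ x, (r - s)⁻¹ * (ψ (Y r x) - ψ (Y s x)) ∂(ρ r))
        (nhdsWithin s (Ici 0 \ {s})) (nhds (∫ x, D s x ∂(ρ s))) :=
      tendsto_integral_of_uniform (hself.mono hprob)
        (hself.mono fun r hr => ((hψi r r hr hr).sub (hψi r s hr hs)).const_mul _)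
        (hself.mono fun r hr => hDi r s hr hs) hquot
        ((hcont (D s) (hDc s hs) (hDcs s hs) s hs).mono_left (nhdsWithin_mono s sdiff_subset))
    have h2 := hasDerivWithinAt_iff_tendsto_slope.1
      (hweak (fun x => ψ (Y s x)) (hψ.comp (hYs s)) (hcs s hs) s hs)
    have h3 : ∫ x, fderiv ℝ (fun x => ψ (Y s x)) x (matCLM (B s) x + b s) ∂(ρ s) =
        -∫ x, D s x ∂(ρ s) := by
      rw [← integral_neg]
      refine integral_congr_ae (.of_forall fun x => ?_)
      have h4 : HasFDerivAt (fun x => ψ (Y s x)) ((fderiv ℝ ψ (Y s x)).comp (matCLM (Ψ s))) x :=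
        (hψd (Y s x)).hasFDerivAt.comp x ((matCLM (Ψ s)).hasFDerivAt.add_const (c s))
      simp only [hD, h4.fderiv, map_neg, neg_neg, ContinuousLinearMap.comp_apply]
    rw [hasDerivWithinAt_iff_tendsto_slope]
    rw [h3] at h2
    have h5 := h1.add h2
    rw [add_neg_cancel] at h5
    refine h5.congr' ?_
    filter_upwards [hself] with r hr
    rw [integral_const_mul, integral_sub (hψi r r hr hr) (hψi r s hr hs), slope_def_field,
      slope_def_field]
    ring
  rw [constant_of_hasDerivWithinAt_zero key ht]
  refine integral_congr_ae (.of_forall fun x => ?_)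
  simp only [hY, hΨ0, hc0, add_zero, matCLM_one_apply]

end Transport

/-! ### Uniqueness of weak solutions -/

section Uniqueness

variable {d : ℕ}

open scoped Matrix.Norms.Frobenius

theorem IsWeakSolution.memLp {Q : Matrix (Fin d) (Fin d) ℝ} (hQ : Q.PosDef) {K : MFKernel d}
    {ν : Measure (E d)} {ρ : ℝ → Measure (E d)}
    (hρ : IsWeakSolution K (potential (gaussianDensity Q)) ν ρ) {t : ℝ} (ht : 0 ≤ t) :
    MemLp (fun x : E d => x) 2 (ρ t) := by
  obtain ⟨C, hC, hC₁, -⟩ := exists_potential_bounds hQ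
  obtain ⟨M, hM⟩ := hρ.bounded t
  have hVc : Continuous (potential (gaussianDensity Q)) := by
    rw [funext (potential_gaussianDensity hQ)]
    fun_prop
  have hint : Integrable (fun x => 1 + |potential (gaussianDensity Q) x|) (ρ t) := by
    refine (lintegral_ofReal_ne_top_iff_integrable (by fun_prop)
      (.of_forall fun x => by positivity)).1 ?_
    exact ((hM t ⟨ht, le_rfl⟩).trans_lt ENNReal.coe_lt_top).ne
  refine (memLp_two_iff_integrable_sq_norm (by fun_prop)).2 ?_
  refine (hint.const_mul C).mono' (by fun_prop) (.of_forall fun x => ?_)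
  rw [Real.norm_of_nonneg (by positivity)]
  linarith [hC₁ x]

theorem IsWeakSolution.continuousOn_integral_of_growth {Q : Matrix (Fin d) (Fin d) ℝ}
    (hQ : Q.PosDef) {K : MFKernel d} {ν : Measure (E d)} {ρ : ℝ → Measure (E d)}
    (hρ : IsWeakSolution K (potential (gaussianDensity Q)) ν ρ) {f : E d → ℝ} (hf : Continuous f)
    {M : ℝ} (hM : 0 ≤ M) (hfb : ∀ x, |f x| ≤ M * (1 + ‖x‖ ^ 2)) :
    ContinuousOn (fun t => ∫ x, f x ∂(ρ t)) (Ici 0) := by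
  obtain ⟨C, hC, hC₁, -⟩ := exists_potential_bounds hQ
  refine hρ.continuous f hf ⟨M * C, fun x => (hfb x).trans ?_⟩
  rw [mul_assoc]
  exact mul_le_mul_of_nonneg_left (hC₁ x) hM

theorem IsWeakSolution.continuousOn_secondMoment {Q : Matrix (Fin d) (Fin d) ℝ}
    (hQ : Q.PosDef) {K : MFKernel d} {ν : Measure (E d)} {ρ : ℝ → Measure (E d)}
    (hρ : IsWeakSolution K (potential (gaussianDensity Q)) ν ρ) :
    ContinuousOn (fun t => secondMoment (ρ t)) (Ici 0) := by
  refine continuousOn_pi.2 fun i => continuousOn_pi.2 fun j => ?_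
  refine hρ.continuousOn_integral_of_growth hQ (by fun_prop) zero_le_one fun x => ?_
  have h1 := PiLp.norm_apply_le x i
  have h2 := PiLp.norm_apply_le x j
  rw [Real.norm_eq_abs] at h1 h2
  rw [abs_mul]
  nlinarith [abs_nonneg (x i), abs_nonneg (x j), norm_nonneg x]

theorem IsWeakSolution.continuousOn_mean {Q : Matrix (Fin d) (Fin d) ℝ}
    (hQ : Q.PosDef) {K : MFKernel d} {ν : Measure (E d)} {ρ : ℝ → Measure (E d)}
    (hρ : IsWeakSolution K (potential (gaussianDensity Q)) ν ρ) :
    ContinuousOn (fun t => mean (ρ t)) (Ici 0) := by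
  have h : ContinuousOn (fun t => fun i : Fin d => ∫ x, x i ∂(ρ t)) (Ici 0) := by
    refine continuousOn_pi.2 fun i => ?_
    refine hρ.continuousOn_integral_of_growth hQ (by fun_prop) zero_le_one fun x => ?_
    have h1 := PiLp.norm_apply_le x i
    rw [Real.norm_eq_abs] at h1
    nlinarith [sq_nonneg (‖x‖ - 1)]
  refine ((PiLp.continuous_toLp 2 _).comp_continuousOn h).congr fun t ht => ?_
  have := hρ.probability t ht
  ext i
  have h1 := ContinuousLinearMap.integral_comp_comm (EuclideanSpace.proj (𝕜 := ℝ) i)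
    ((hρ.memLp hQ ht).integrable (by norm_num))
  exact h1.symm

theorem IsWeakSolution.continuousOn_integral_of_compact_support {Q : Matrix (Fin d) (Fin d) ℝ}
    (hQ : Q.PosDef) {K : MFKernel d} {ν : Measure (E d)} {ρ : ℝ → Measure (E d)}
    (hρ : IsWeakSolution K (potential (gaussianDensity Q)) ν ρ) (f : E d → ℝ) (hf : Continuous f)
    (hc : HasCompactSupport f) : ContinuousOn (fun t => ∫ x, f x ∂(ρ t)) (Ici 0) := by
  obtain ⟨M, hM⟩ := hf.bounded_above_of_compact_support hc
  have hM0 : 0 ≤ M := (norm_nonneg _).trans (hM 0)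
  refine hρ.continuousOn_integral_of_growth hQ hf hM0 fun x => (hM x).trans ?_
  nlinarith [mul_nonneg hM0 (sq_nonneg ‖x‖)]

/-- Freezing the coefficients of the velocity field turns the equation into a linear transport
equation, so a weak solution is the image of its initial value under an affine flow. Its mean
then solves a homogeneous linear equation and stays zero, which leaves a centered Gaussian whose
covariance satisfies the Riccati equation. -/
theorem IsWeakSolution.eq_gaussian {Q S₀ : Matrix (Fin d) (Fin d) ℝ} (hS₀ : S₀.PosDef)
    (hQ : Q.PosDef) {S : ℝ → Matrix (Fin d) (Fin d) ℝ} (hS : IsRiccatiSolution Q S₀ S)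
    {K : MFKernel d} (hK : K = kernelOne d ∨ K = kernelTwo d) {ρ : ℝ → Measure (E d)}
    (hρ : IsWeakSolution K (potential (gaussianDensity Q)) (multivariateGaussian 0 S₀) ρ)
    {t : ℝ} (ht : 0 ≤ t) : ρ t = multivariateGaussian 0 (S t) := by
  obtain ⟨β, γ, hβ, hγ, hβ0, hU⟩ := exists_velocity_coefficients hQ hK
  have hmom : ContinuousOn (fun t => (secondMoment (ρ t), mean (ρ t))) (Ici 0) :=
    (hρ.continuousOn_secondMoment hQ).prodMk (hρ.continuousOn_mean hQ)
  set B : ℝ → Matrix (Fin d) (Fin d) ℝ := fun t => β (secondMoment (ρ t), mean (ρ t)) with hB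
  set Γ : ℝ → Matrix (Fin d) (Fin d) ℝ := fun t => γ (secondMoment (ρ t), mean (ρ t)) with hΓ
  set m : ℝ → E d := fun t => mean (ρ t) with hm
  have hBc : ContinuousOn B (Ici 0) := hβ.comp_continuousOn hmom
  have hΓc : ContinuousOn Γ (Ici 0) := hγ.comp_continuousOn hmom
  have hbc : ContinuousOn (fun t => matCLM (Γ t) (m t)) (Ici 0) :=
    (continuous_matCLM.comp_continuousOn hΓc).clm_apply (hρ.continuousOn_mean hQ)
  obtain ⟨Φ, Ψ, hΦ0, hΨ0, hΦ, hΨ, hΨΦ⟩ := exists_fundamental_matrix hBc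
  have hΦc : ContinuousOn Φ (Ici 0) := fun t ht => (hΦ t ht).continuousWithinAt
  have hΨc : ContinuousOn Ψ (Ici 0) := fun t ht => (hΨ t ht).continuousWithinAt
  have hΦΨ : ∀ t, 0 ≤ t → Φ t * Ψ t = 1 := fun t ht => mul_eq_one_comm.1 (hΨΦ t ht)
  obtain ⟨c, hc0, -, hc⟩ := exists_primitive_Ici (f := fun t => -matCLM (Ψ t) (matCLM (Γ t) (m t)))
    ((continuous_matCLM.comp_continuousOn hΨc).clm_apply hbc).neg
  have hvel : ∀ t, 0 ≤ t → ∀ x, svgdVelocity K (potential (gaussianDensity Q)) (ρ t) x =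
      matCLM (B t) x + matCLM (Γ t) (m t) := fun t ht x =>
    have := hρ.probability t ht
    hU (ρ t) (hρ.memLp hQ ht) x
  have hcont := hρ.continuousOn_integral_of_compact_support hQ
  -- inverting the affine map expresses `ρ t` through the initial value
  have hmap : ∀ t, 0 ≤ t → ρ t =
      (multivariateGaussian 0 S₀).map fun y => matCLM (Φ t) (y - c t) := by
    intro t ht
    have h := map_inverse_flow_eq hρ.probability hBc hbc hcont
      (fun ψ hψ hψc => hasDerivWithinAt_integral_of_weak hρ hBc hbc hvel hcont hψ hψc)
      hΦc hΨ0 hc0 hΨ hc hΨΦ ht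
    rw [← hρ.initial, ← h, Measure.map_map (by fun_prop) (by fun_prop)]
    refine (Measure.map_id.symm).trans (congrArg (fun f => Measure.map f (ρ t)) ?_)
    funext x
    simp [← matCLM_mul_apply, hΦΨ t ht]
  have hmean : ∀ t, 0 ≤ t → m t = -matCLM (Φ t) (c t) := by
    intro t ht
    have hint : Integrable (fun y : E d => y) (multivariateGaussian 0 S₀) :=
      (memLp_two_multivariateGaussian S₀).integrable (by norm_num)
    have h0 : ∫ y : E d, y ∂(multivariateGaussian 0 S₀) = 0 := mean_multivariateGaussian S₀
    have hint' : Integrable (fun y : E d => y - c t) (multivariateGaussian 0 S₀) :=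
      hint.sub (integrable_const _)
    rw [hm]
    simp only [mean]
    rw [hmap t ht, integral_map (by fun_prop) (by fun_prop),
      ContinuousLinearMap.integral_comp_comm _ hint', integral_sub hint (integrable_const _), h0]
    simp
  have hm0 : ∀ t, 0 ≤ t → m t = 0 := by
    refine eq_zero_of_linear (hBc.add hΓc) (by rw [hmean 0 le_rfl, hc0]; simp) fun t ht => ?_
    have h1 := ((hasDerivWithinAt_matCLM (hΦ t ht)).clm_apply (hc t ht)).neg
    refine (h1.congr_of_mem (fun s hs => hmean s hs) ht).congr_deriv ?_
    have h2 : matCLM (B t * Φ t) (c t) = -matCLM (B t) (m t) := by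
      rw [hmean t ht, map_neg, neg_neg, matCLM_mul_apply]
    have h3 : matCLM (Φ t) (matCLM (Ψ t) (matCLM (Γ t) (m t))) = matCLM (Γ t) (m t) := by
      rw [← matCLM_mul_apply, hΦΨ t ht, matCLM_one_apply]
    rw [map_neg, h2, h3]
    simp [matCLM, add_comm]
  have hgauss : ∀ t, 0 ≤ t → ρ t = multivariateGaussian 0 (Φ t * S₀ * (Φ t)ᵀ) := by
    intro t ht
    have hct : c t = 0 := by
      have h1 : matCLM (Φ t) (c t) = 0 := by rw [← neg_eq_zero, ← hmean t ht, hm0 t ht]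
      rw [← matCLM_one_apply (c t), ← hΨΦ t ht, matCLM_mul_apply, h1, map_zero]
    rw [hmap t ht, ← map_multivariateGaussian hS₀.posSemidef]
    simp only [hct, sub_zero]
  have hBt : ∀ t, 0 ≤ t → B t = 1 - Q⁻¹ * (Φ t * S₀ * (Φ t)ᵀ) := by
    intro t ht
    have h1 : mean (ρ t) = 0 := hm0 t ht
    rw [← hβ0, hB]
    simp only
    rw [h1, hgauss t ht, secondMoment_multivariateGaussian
      (posDef_congr_of_left_inverse hS₀ (hΨΦ t ht)).posSemidef]
  have hric := isRiccatiSolution_of_flow hS₀ hQ hΦ0 fun t ht => hBt t ht ▸ hΦ t ht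
  rw [hgauss t ht, riccati_unique hS hric t ht]

end Uniqueness

end GaussianSVGD

theorem mainTheorem7 (d : ℕ) (S₀ Q : Matrix (Fin d) (Fin d) ℝ)
    (hS₀ : S₀.PosDef) (hQ : Q.PosDef) :
    ∃ S : ℝ → Matrix (Fin d) (Fin d) ℝ,
      -- the Riccati equation has a unique global solution, and it stays positive definite
      GaussianSVGD.IsRiccatiSolution Q S₀ S ∧
      (∀ t, 0 ≤ t → (S t).PosDef) ∧
      (∀ S' : ℝ → Matrix (Fin d) (Fin d) ℝ, GaussianSVGD.IsRiccatiSolution Q S₀ S' →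
        ∀ t, 0 ≤ t → S' t = S t) ∧
      -- `N(0, S t)` has the usual Gaussian density
      (∀ t, 0 ≤ t → multivariateGaussian 0 (S t) =
        GaussianSVGD.densityMeasure (GaussianSVGD.gaussianDensity (S t))) ∧
      -- for both kernels, `N(0, S t)` is the solution of the SVGD equation
      (∀ K : GaussianSVGD.MFKernel d,
        K = GaussianSVGD.kernelOne d ∨ K = GaussianSVGD.kernelTwo d →
        GaussianSVGD.IsClassicalSolution K
          (GaussianSVGD.potential (GaussianSVGD.gaussianDensity Q))
          (GaussianSVGD.gaussianDensity S₀) (fun t => GaussianSVGD.gaussianDensity (S t)) ∧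
        GaussianSVGD.IsWeakSolution K
          (GaussianSVGD.potential (GaussianSVGD.gaussianDensity Q))
          (multivariateGaussian 0 S₀) (fun t => multivariateGaussian 0 (S t)) ∧
        ∀ ρ : ℝ → Measure (GaussianSVGD.E d),
          GaussianSVGD.IsWeakSolution K
            (GaussianSVGD.potential (GaussianSVGD.gaussianDensity Q))
            (multivariateGaussian 0 S₀) ρ →
          ∀ t, 0 ≤ t → ρ t = multivariateGaussian 0 (S t)) ∧
      -- closed form in the commuting case
      (S₀ * Q = Q * S₀ → ∀ t, 0 ≤ t →
        (S t)⁻¹ = Real.exp (-2 * t) • S₀⁻¹ + (1 - Real.exp (-2 * t)) • Q⁻¹) ∧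
      -- closed form for a rank-one perturbation of the identity
      (∀ (η : ℝ) (v : Fin d → ℝ), 0 < η → v ⬝ᵥ v = 1 →
        S₀ = 1 → Q = 1 + η • vecMulVec v v → ∀ t, 0 ≤ t →
        S t = 1 + (η * (1 - Real.exp (-2 * t)) / (1 + η * Real.exp (-2 * t))) •
          vecMulVec v v) := by
  obtain ⟨Φ, Ψ, hΦ0, hΨΦ, hΦ⟩ := GaussianSVGD.exists_riccati_invertible_flow hS₀ hQ
  have hS := GaussianSVGD.isRiccatiSolution_of_flow hS₀ hQ hΦ0 hΦ
  have hpos : ∀ t, 0 ≤ t → (Φ t * S₀ * (Φ t)ᵀ).PosDef := fun t ht =>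
    GaussianSVGD.posDef_congr_of_left_inverse hS₀ (hΨΦ t ht)
  refine ⟨fun t => Φ t * S₀ * (Φ t)ᵀ, hS, hpos, fun S' hS' => GaussianSVGD.riccati_unique hS hS',
    fun t ht => GaussianSVGD.multivariateGaussian_eq_densityMeasure (hpos t ht),
    fun K hK => ⟨GaussianSVGD.isClassicalSolution_gaussian hQ hS hpos hK,
      GaussianSVGD.isWeakSolution_gaussian hS₀ hQ hΦ0 hΨΦ hΦ hK,
      fun ρ hρ t ht => hρ.eq_gaussian hS₀ hQ hS hK ht⟩,
    fun hcomm t ht => GaussianSVGD.riccati_commuting hS₀ hQ hS hcomm ht, ?_⟩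
  intro η v hη hv h1 hQ1 t ht
  subst h1 hQ1
  exact GaussianSVGD.riccati_rank_one hη hv hS hQ ht ((hpos t ht).det_pos.ne'.isUnit)
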